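/- **Theorem (Same Entanglement).** Let $q$ be a prime power and let $n,\kappa,\delta,c$ be integers with $\kappa>0$ and $c>0$. If there exists a pure $[\![n,\kappa,\delta;c]\!]_q$-code $\mathcal Q$ obtained by the Hermitian construction, then there exist an integer $\delta'$ with $\delta\le\delta'\le\delta+1$ and an $[\![n+1,\kappa-1,\delta';c]\!]_q$-code $\mathcal Q'$ that is pure to distance $\delta'$. Here the terms have the following meaning. For a linear code $\mathcal C\subseteq\mathbb F_{q^2}^n$ of dimension $k$ let $\mathcal C^{\perp_{\rm H}}=\{x:\sum_i x_iy_i^q=0\text{ for all }y\in\mathcal C\}$, and let ${\rm wt}(S)$ denote the least Hamming weight of a nonzero vector of $S$. The *Hermitian construction*, applied to $\mathcal C$, gives an $[\![n,\kappa,\delta;c]\!]_q$-code with $c=k-\dim(\mathcal C\cap\mathcal C^{\perp_{\rm H}})$, $\kappa=n-2k+c$, and $\delta={\rm wt}(\mathcal C^{\perp_{\rm H}})$ if $\mathcal C^{\perp_{\rm H}}\subseteq\mathcal C$, $\delta={\rm wt}\bigl(\mathcal C^{\perp_{\rm H}}\setminus(\mathcal C\cap\mathcal C^{\perp_{\rm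 H}})\bigr)$ otherwise; this code is *pure* if $\delta={\rm wt}(\mathcal C^{\perp_{\rm H}})$. An *$[\![n,\kappa,\delta;c]\!]_q$-code* is an entanglement-assisted quantum code, that is, a subspace $\mathcal Q$ of $(\mathbb C^q)^{\otimes n}\otimes(\mathbb C^q)^{\otimes c}$ consisting of the vectors $(U\otimes 1)\bigl(\psi\otimes|0\rangle^{\otimes(n-\kappa-c)}\otimes|\Phi\rangle^{\otimes c}\bigr)$, $\psi\in(\mathbb C^q)^{\otimes\kappa}$, where $|\Phi\rangle=q^{-1/2}\sum_b|b\rangle|b\rangle$ and $U$ is a unitary on all qudits but the receiver's $c$ halves of the maximally entangled pairs, and whose minimum distance is $\delta$. With $P$ the projector onto $\mathcal Q$, the code is *pure to distance $d$* if $P(E\otimes1)P=\frac{{\rm tr}E}{q^n}P$ for every operator $E$ acting on fewer than $d$ of the $n$ transmitted qudits. The *minimum distance* is the largest $d\le n+1$ such that $P(E\otimes 1)P$ is a multiple of $P$ for every such $E$; if $\kappa=0$, it is the largest $d\le n+1$ such that $\mathcal Q$ is pure to distance $d$. -/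

import Mathlib

namespace EAQ

/-! ### Classical linear codes and the parameters of the Hermitian construction -/

section Classical

variable {K : Type*} [Field K] {n : ℕ}

/-- The Hermitian dual of a linear code `C` of length `n` over a field `K` with `q ^ 2`
elements: all `x` with `∑ i, x i * (y i) ^ q = 0` for every codeword `y`. -/
def hermitianDual (q : ℕ) (C : Submodule K (Fin n → K)) : Submodule K (Fin n → K) where
  carrier := {x | ∀ y ∈ C, ∑ i, x i * (y i) ^ q = 0}
  add_mem' := by
    intro a b ha hb y hy
    simp only [Pi.add_apply, add_mul, Finset.sum_add_distrib, ha y hy, hb y hy, add_zero]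
  zero_mem' := by
    intro y _
    simp
  smul_mem' := by
    intro r x hx y hy
    simp only [Pi.smul_apply, smul_eq_mul, mul_assoc, ← Finset.mul_sum, hx y hy, mul_zero]

/-- The Hermitian hull, the intersection of a code with its Hermitian dual. -/
def hermitianHull (q : ℕ) (C : Submodule K (Fin n → K)) : Submodule K (Fin n → K) :=
  C ⊓ hermitianDual q C

variable [DecidableEq K]

/-- `wt(S) = w`: the least Hamming weight of a nonzero vector of `S` is `w`
(in particular `S` contains a nonzero vector). -/
def IsMinWeight (S : Set (Fin n → K)) (w : ℕ) : Prop :=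
  IsLeast {t : ℕ | ∃ v ∈ S, v ≠ 0 ∧ hammingNorm v = t} w

/-- The Hermitian construction, applied to the linear code `C` of length `n` over the field
with `q ^ 2` elements, has the parameters `[[n, κ, δ; c]]_q`. -/
structure HermitianConstruction (q : ℕ) (C : Submodule K (Fin n → K)) (κ δ c : ℕ) : Prop where
  /-- `c = k - dim (C ∩ C^⊥)`, with `k = dim C`. -/
  ebits : (c : ℤ) = (Module.finrank K C : ℤ) - (Module.finrank K (hermitianHull q C) : ℤ)
  /-- `κ = n - 2 k + c`. -/
  logical : (κ : ℤ) = (n : ℤ) - 2 * (Module.finrank K C : ℤ) + (c : ℤ)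
  /-- `δ = wt (C^⊥)` if `C^⊥ ⊆ C`. -/
  dist_of_le : hermitianDual q C ≤ C → IsMinWeight (hermitianDual q C : Set (Fin n → K)) δ
  /-- `δ = wt (C^⊥ \ (C ∩ C^⊥))` otherwise. -/
  dist_of_not_le : ¬ hermitianDual q C ≤ C →
    IsMinWeight ((hermitianDual q C : Set (Fin n → K)) \ (hermitianHull q C : Set (Fin n → K))) δ

/-- The Hermitian construction, applied to `C`, gives a pure code with the parameters
`[[n, κ, δ; c]]_q`: moreover `δ = wt (C^⊥)`. -/
def PureHermitianConstruction (q : ℕ) (C : Submodule K (Fin n → K)) (κ δ c : ℕ) : Prop :=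
  HermitianConstruction q C κ δ c ∧ IsMinWeight (hermitianDual q C : Set (Fin n → K)) δ

end Classical

/-! ### Entanglement-assisted quantum codes

A qudit is the Hilbert space with an orthonormal basis labelled by the finite type `A`, so
that `n` qudits form `EuclideanSpace ℂ (Fin n → A)`. The sender transmits `n` qudits and the
receiver holds `c` further qudits, his halves of the `c` maximally entangled pairs. -/

section Quantum

variable {A : Type} [Fintype A] [DecidableEq A]

/-- The joint space of the `n` transmitted qudits and the `c` qudits of the receiver. -/
abbrev JointSpace (A : Type) (n c : ℕ) : Type :=
  EuclideanSpace ℂ ((Fin n → A) × (Fin c → A))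

/-- The `κ` logical qudits in the state `ψ`, with `m` ancillas in the basis state `|a₀ … a₀⟩`
and the sender's `c` halves of the maximally entangled pairs in the basis state `|b⟩`. -/
noncomputable def inputState (a₀ : A) {κ c : ℕ} (m : ℕ)
    (ψ : EuclideanSpace ℂ (Fin κ → A)) (b : Fin c → A) :
    EuclideanSpace ℂ ((Fin κ → A) × (Fin m → A) × (Fin c → A)) :=
  WithLp.toLp 2 fun p => if p.2.1 = (fun _ => a₀) ∧ p.2.2 = b then ψ p.1 else 0

/-- The encoded state `(U ⊗ 1) (|ψ⟩ ⊗ |a₀ … a₀⟩ ⊗ |Φ⟩)`, where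
`|Φ⟩ = |A| ^ (-c / 2) ∑ b, |b⟩ ⊗ |b⟩` consists of `c` maximally entangled pairs and the encoder
`U` acts on all qudits but those of the receiver. -/
noncomputable def encode (a₀ : A) {n κ m c : ℕ}
    (U : EuclideanSpace ℂ ((Fin κ → A) × (Fin m → A) × (Fin c → A)) ≃ₗᵢ[ℂ]
      EuclideanSpace ℂ (Fin n → A))
    (ψ : EuclideanSpace ℂ (Fin κ → A)) : JointSpace A n c :=
  WithLp.toLp 2 fun p =>
    (((Real.sqrt ((Fintype.card A : ℝ) ^ c))⁻¹ : ℝ) : ℂ) * U (inputState a₀ m ψ p.2) p.1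

/-- `Q` is the code of an encoding of `κ` logical qudits into `n` qudits by means of a unitary
encoder, `n - κ - c` ancillas and `c` maximally entangled pairs. -/
def IsEncodedSpace {n c : ℕ} (κ : ℕ) (Q : Submodule ℂ (JointSpace A n c)) : Prop :=
  ∃ m : ℕ, κ + m + c = n ∧
    ∃ (a₀ : A) (U : EuclideanSpace ℂ ((Fin κ → A) × (Fin m → A) × (Fin c → A)) ≃ₗᵢ[ℂ]
        EuclideanSpace ℂ (Fin n → A)),
      (Q : Set (JointSpace A n c)) = Set.range (encode a₀ U)

/-- The operator `M` on `n` qudits acts only on the qudits in `S`: it is of the form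
`N ⊗ 1`, with an arbitrary operator `N` on the qudits in `S`. -/
def ActsOn {n : ℕ} (S : Finset (Fin n)) (M : Matrix (Fin n → A) (Fin n → A) ℂ) : Prop :=
  ∃ N : Matrix (S → A) (S → A) ℂ, ∀ x y : Fin n → A,
    M x y = if ∀ i, i ∉ S → x i = y i then N (fun i => x i) (fun i => y i) else 0

/-- The operator `M ⊗ 1`: the error `M` affects the transmitted qudits only. -/
noncomputable def applyError {n c : ℕ} (M : Matrix (Fin n → A) (Fin n → A) ℂ)
    (φ : JointSpace A n c) : JointSpace A n c :=
  WithLp.toLp 2 fun p => ∑ y : Fin n → A, M p.1 y * φ (y, p.2)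

/-- `Q` detects every error on fewer than `d` of the transmitted qudits (Knill–Laflamme):
with `P` the projector onto `Q`, `P (M ⊗ 1) P` is a multiple of `P`. -/
def DetectsBelow {n c : ℕ} (Q : Submodule ℂ (JointSpace A n c)) (d : ℕ) : Prop :=
  ∀ S : Finset (Fin n), S.card < d → ∀ M : Matrix (Fin n → A) (Fin n → A) ℂ, ActsOn S M →
    ∃ z : ℂ, ∀ φ ∈ Q, ∀ ψ ∈ Q, inner ℂ φ (applyError M ψ) = z * inner ℂ φ ψ

/-- `Q` is pure to distance `d`: with `P` the projector onto `Q`,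
`P (M ⊗ 1) P = (tr M / |A| ^ n) P` for every error `M` on fewer than `d` of the transmitted
qudits. Equivalently, `P (M ⊗ 1) P = 0` for every traceless such error `M` (such as a
nonidentity generalized Pauli error); in particular none of these acts trivially on `Q`. -/
def PureTo {n c : ℕ} (Q : Submodule ℂ (JointSpace A n c)) (d : ℕ) : Prop :=
  ∀ S : Finset (Fin n), S.card < d → ∀ M : Matrix (Fin n → A) (Fin n → A) ℂ, ActsOn S M →
    ∀ φ ∈ Q, ∀ ψ ∈ Q,
      inner ℂ φ (applyError M ψ) = M.trace / (Fintype.card A : ℂ) ^ n * inner ℂ φ ψ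

/-- `Q` is an entanglement-assisted code with the parameters `[[n, κ, δ; c]]`, for qudits of
dimension `|A|`: it encodes `κ` logical qudits with the help of `c` maximally entangled pairs,
and its minimum distance is exactly `δ`. The minimum distance is the largest `d ≤ n + 1` such
that all errors on fewer than `d` qudits are detected; as usual, for the one-dimensional codes
`κ = 0` it is the largest `d ≤ n + 1` such that the code is pure to distance `d`. -/
def IsEAQECC {n c : ℕ} (Q : Submodule ℂ (JointSpace A n c)) (κ δ : ℕ) : Prop :=
  IsEncodedSpace κ Q ∧
    IsGreatest {d : ℕ | d ≤ n + 1 ∧ DetectsBelow Q d ∧ (κ = 0 → PureTo Q d)} δ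

end Quantum

end EAQ

/-! Writing F_{q²} = F_q + γ F_q turns C into an F_q-subspace of the symplectic space F_q^{2n} and
its Hermitian dual into the symplectic complement D. With R = C ∩ D one has dim C = dim R + 2c and
dim D = dim R + 2κ: modulo R, C consists of c hyperbolic planes, which the receiver's qudits make
commute, and D of κ hyperbolic planes, the logical operators.

One logical qudit is spent on the new position: a hyperbolic pair v₁, v₂ of D is made commuting by
one further transmitted qudit and adjoined to the stabilizer (`extendedStabilizer`). The planes of C
are untouched, so c stays. The Weyl operators on the n + 1 transmitted qudits that commute with the
new stabilizer are the words of D, prolonged by a coordinate that records their pairings with v₁,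
v₂. Hence weights grow by at most one, and purity of the original code bounds all of them below by
δ. If κ > 1, the pair can be chosen orthogonal to a word x ∈ D \ C of weight δ, which then survives
as a logical operator of the same weight, so δ' = δ. If κ = 1, the new code is one-dimensional and
δ' is the least weight of a prolonged word, δ or δ + 1.

On the quantum side, an isotropic S has a common eigenspace of dimension q^{n+c} / |S|
(`exists_stabilizerCode`), on which Weyl operators not commuting with S have no matrix elements. By
Fourier inversion (`sum_fiber_eq`), if this holds for all nonidentity Weyl operators of a subsystem,
the reduced states there are maximally mixed. On few transmitted qudits this is purity; on the
receiver's qudits it produces a unitary encoder (`isEncodedSpace_of_receiver_mixed`). -/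

namespace EAQ

/-! ### Weyl operators and the symplectic form -/

section Weyl

variable {A X : Type} [Field A] [AddCommGroup X] [Module A X]

/-- The symplectic form on `X × X` that belongs to a bilinear pairing on `X`. -/
def symp (d : LinearMap.BilinForm A X) : LinearMap.BilinForm A (X × X) :=
  LinearMap.mk₂ A (fun w w' => d w.2 w'.1 - d w'.2 w.1)
    (fun _ _ _ => by simp only [Prod.snd_add, Prod.fst_add, map_add, LinearMap.add_apply]; ring)
    (fun _ _ _ => by
      simp only [Prod.smul_snd, Prod.smul_fst, map_smul, LinearMap.smul_apply, smul_eq_mul]; ring)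
    (fun _ _ _ => by simp only [Prod.snd_add, Prod.fst_add, map_add, LinearMap.add_apply]; ring)
    (fun _ _ _ => by
      simp only [Prod.smul_snd, Prod.smul_fst, map_smul, LinearMap.smul_apply, smul_eq_mul]; ring)

@[simp]
lemma symp_apply (d : LinearMap.BilinForm A X) (w w' : X × X) :
    symp d w w' = d w.2 w'.1 - d w'.2 w.1 := rfl

lemma symp_isAlt (d : LinearMap.BilinForm A X) : (symp d).IsAlt := fun w => by simp

lemma symp_neg (d : LinearMap.BilinForm A X) (w w' : X × X) : symp d w w' = -symp d w' w := by
  simp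

lemma symp_nondegenerate {d : LinearMap.BilinForm A X} (hd : d.Nondegenerate) :
    (symp d).Nondegenerate := by
  have key : ∀ w : X × X, (∀ w', symp d w w' = 0) → w = 0 := by
    rintro ⟨a, b⟩ h
    have hb : b = 0 := hd.1 b fun y => by simpa using h (y, 0)
    have ha : a = 0 := hd.2 a fun y => by simpa using h (0, y)
    simp [ha, hb]
  exact ⟨key, fun w h => key w fun w' => by rw [symp_neg, h w', neg_zero]⟩

/-- The Weyl operator (generalized Pauli error) with shift `w.1` and phase `w.2`. -/
noncomputable def weyl (χ : AddChar A ℂ) (d : LinearMap.BilinForm A X) (w : X × X) :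
    Module.End ℂ (EuclideanSpace ℂ X) where
  toFun φ := WithLp.toLp 2 fun x => χ (d w.2 x) * φ (x - w.1)
  map_add' φ ψ := by ext x; simp [mul_add]
  map_smul' r φ := by ext x; simp [mul_left_comm]

variable (χ : AddChar A ℂ) (d : LinearMap.BilinForm A X)

@[simp]
lemma weyl_apply (w : X × X) (φ : EuclideanSpace ℂ X) (x : X) :
    weyl χ d w φ x = χ (d w.2 x) * φ (x - w.1) := rfl

lemma weyl_zero : weyl χ d 0 = 1 := by
  ext φ x; simp

lemma weyl_mul (w w' : X × X) :
    weyl χ d w * weyl χ d w' = χ (-d w'.2 w.1) • weyl χ d (w + w') := by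
  ext φ x
  simp only [Module.End.mul_apply, weyl_apply, LinearMap.smul_apply, PiLp.smul_apply, smul_eq_mul,
    Prod.snd_add, Prod.fst_add, map_add, LinearMap.add_apply, map_neg, sub_eq_add_neg,
    AddChar.map_add_eq_mul, neg_add_rev, add_assoc]
  rw [add_comm (-w'.1)]
  ring

lemma weyl_comm (w w' : X × X) :
    weyl χ d w * weyl χ d w' = χ (symp d w w') • (weyl χ d w' * weyl χ d w) := by
  rw [weyl_mul, weyl_mul, smul_smul, ← AddChar.map_add_eq_mul, add_comm w' w, symp_apply]
  congr 2
  ring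

lemma inner_weyl_weyl [Fintype X] [Finite A] (w : X × X) (φ ψ : EuclideanSpace ℂ X) :
    inner ℂ (weyl χ d w φ) (weyl χ d w ψ) = inner ℂ φ ψ := by
  rw [PiLp.inner_apply, PiLp.inner_apply, ← Equiv.sum_comp (Equiv.addRight w.1)]
  refine Finset.sum_congr rfl fun x _ => ?_
  have h : (starRingEnd ℂ) (χ (d w.2 (x + w.1))) * χ (d w.2 (x + w.1)) = 1 := by
    rw [← Complex.normSq_eq_conj_mul_self, Complex.normSq_eq_norm_sq, AddChar.norm_apply]
    simp
  simp only [weyl_apply, Equiv.coe_addRight, add_sub_cancel_right, RCLike.inner_apply, map_mul]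
  linear_combination (ψ x * (starRingEnd ℂ) (φ x)) * h

variable {χ d}

/-- Orthogonality of the characters of `X`. -/
lemma sum_char_eq_ite [Fintype X] [DecidableEq X] (hχ : χ ≠ 0) (hd : d.Nondegenerate) (x : X) :
    ∑ b : X, χ (d b x) = if x = 0 then (Fintype.card X : ℂ) else 0 := by
  classical
  have h := AddChar.sum_eq_ite (χ.compAddMonoidHom ((d.flip x).toAddMonoidHom))
  simp only [AddChar.compAddMonoidHom_apply, LinearMap.toAddMonoidHom_coe,
    LinearMap.BilinForm.flip_apply] at h
  rw [h]
  congr 1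
  refine propext ⟨fun h0 => ?_, fun h0 => by ext; simp [h0]⟩
  refine hd.2 x fun b => ?_
  by_contra hb
  obtain ⟨t, ht⟩ : ∃ t, χ t ≠ 1 := by
    by_contra! hh; exact hχ (by ext; simp [hh])
  refine ht ?_
  have := DFunLike.congr_fun h0 ((t / d b x) • b)
  simpa [hb] using this

/-- A nonzero shift leaves no diagonal entries; for a pure phase the diagonal is a nontrivial
character, whose sum vanishes. -/
lemma trace_weyl [Fintype X] [DecidableEq X] (hχ : χ ≠ 0) (hd : d.Nondegenerate) {w : X × X} (hw : w ≠ 0) :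
    LinearMap.trace ℂ _ (weyl χ d w) = 0 := by
  rw [LinearMap.trace_eq_matrix_trace ℂ (EuclideanSpace.basisFun X ℂ).toBasis, Matrix.trace]
  have : ∀ x, (LinearMap.toMatrix (EuclideanSpace.basisFun X ℂ).toBasis
      (EuclideanSpace.basisFun X ℂ).toBasis (weyl χ d w)).diag x
      = if w.1 = 0 then χ (d w.2 x) else 0 := by
    intro x
    simp [LinearMap.toMatrix_apply]
  simp_rw [this]
  split_ifs with h
  · have hflip : d.flip.Nondegenerate := ⟨hd.2, hd.1⟩
    have := sum_char_eq_ite hχ hflip w.2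
    simp only [LinearMap.BilinForm.flip_apply] at this
    rw [this, if_neg]
    rintro h2
    exact hw (Prod.ext h h2)
  · simp

end Weyl

/-- Commuting endomorphisms of a nonzero finite-dimensional complex space have a common
eigenvector. -/
lemma exists_common_eigenvector {ι V : Type*} [AddCommGroup V] [Module ℂ V]
    [FiniteDimensional ℂ V] [Nontrivial V] (f : ι → Module.End ℂ V)
    (hf : ∀ i j, Commute (f i) (f j)) :
    ∃ v : V, v ≠ 0 ∧ ∀ i, ∃ z : ℂ, f i v = z • v := by
  -- In a minimal nonzero invariant subspace, an eigenspace of one map is invariant under the others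
  -- by commutation, hence is everything.
  obtain ⟨V₀, ⟨hne, hinv⟩, hmin⟩ := WellFounded.has_min
    (wellFounded_lt (α := Submodule ℂ V)) {V₀ | V₀ ≠ ⊥ ∧ ∀ i, ∀ v ∈ V₀, f i v ∈ V₀}
    ⟨⊤, by simp⟩
  obtain ⟨v, hv, hv0⟩ := V₀.exists_mem_ne_zero_of_ne_bot hne
  refine ⟨v, hv0, fun i => ?_⟩
  have : Nontrivial V₀ := V₀.nontrivial_iff_ne_bot.2 hne
  obtain ⟨z, hz⟩ := Module.End.exists_eigenvalue ((f i).restrict (hinv i))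
  obtain ⟨u, hu⟩ := hz.exists_hasEigenvector
  refine ⟨z, ?_⟩
  have hle : V₀ ⊓ Module.End.eigenspace (f i) z = V₀ := by
    by_contra hlt
    refine hmin (V₀ ⊓ Module.End.eigenspace (f i) z) ⟨?_, ?_⟩
      (lt_of_le_of_ne inf_le_left hlt)
    · rw [Submodule.ne_bot_iff]
      refine ⟨u, ⟨u.2, ?_⟩, fun h => hu.2 (Subtype.ext h)⟩
      rw [SetLike.mem_coe, Module.End.mem_eigenspace_iff]
      exact congrArg Subtype.val hu.apply_eq_smul
    · rintro j x ⟨hx, hx'⟩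
      rw [SetLike.mem_coe, Module.End.mem_eigenspace_iff] at hx'
      refine ⟨hinv j x hx, ?_⟩
      rw [SetLike.mem_coe, Module.End.mem_eigenspace_iff, ← Module.End.mul_apply,
        (hf i j).eq, Module.End.mul_apply, hx', map_smul]
  exact Module.End.mem_eigenspace_iff.1 ((hle.ge hv).2)

/-! ### Stabilizer codes of isotropic subspaces -/

section Stabilizer

variable {A X : Type} [Field A] [AddCommGroup X] [Module A X]

/-- The common eigenspace of the Weyl operators of `S` with the eigenvalues `ev`. -/
noncomputable def stabilizerCode (χ : AddChar A ℂ) (d : LinearMap.BilinForm A X) (S : Submodule A (X × X))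
    (ev : X × X → ℂ) : Submodule ℂ (EuclideanSpace ℂ X) :=
  ⨅ s ∈ S, Module.End.eigenspace (weyl χ d s) (ev s)

variable {χ : AddChar A ℂ} {d : LinearMap.BilinForm A X} {S : Submodule A (X × X)}
  {ev : X × X → ℂ}

lemma mem_stabilizerCode {φ : EuclideanSpace ℂ X} :
    φ ∈ stabilizerCode χ d S ev ↔ ∀ s ∈ S, weyl χ d s φ = ev s • φ := by
  simp [stabilizerCode, Submodule.mem_iInf]

/-- `χ` may be trivial at a given nonzero value, but `P` is a subspace, so `s` can be rescaled until
the form hits a value where `χ` is not 1. -/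
lemma exists_char_ne_one_of_symp_ne_zero (hχ : χ ≠ 0) {P : Submodule A (X × X)} {w : X × X}
    (h : ∃ s ∈ P, symp d s w ≠ 0) : ∃ s ∈ P, χ (symp d s w) ≠ 1 := by
  obtain ⟨s, hs, hsw⟩ := h
  obtain ⟨t, ht⟩ : ∃ t, χ t ≠ 1 := by
    by_contra! hh; exact hχ (by ext; simp [hh])
  refine ⟨(t / symp d s w) • s, P.smul_mem _ hs, ?_⟩
  rw [map_smul, LinearMap.smul_apply, smul_eq_mul, div_mul_cancel₀ _ hsw]
  exact ht

lemma weyl_comp_comm (w w' : X × X) (φ : EuclideanSpace ℂ X) :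
    weyl χ d w (weyl χ d w' φ) = χ (symp d w w') • weyl χ d w' (weyl χ d w φ) := by
  have := congrArg (fun f => f φ) (weyl_comm χ d w w')
  simpa only [Module.End.mul_apply, LinearMap.smul_apply] using this

/-- Weyl operators that commute with the stabilizer preserve the code. -/
lemma weyl_mem_stabilizerCode {w : X × X} (hw : ∀ s ∈ S, symp d s w = 0)
    {ψ : EuclideanSpace ℂ X} (hψ : ψ ∈ stabilizerCode χ d S ev) :
    weyl χ d w ψ ∈ stabilizerCode χ d S ev := by
  rw [mem_stabilizerCode] at hψ ⊢
  intro s hs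
  rw [weyl_comp_comm, hw s hs, hψ s hs, map_smul]
  simp

/-- Weyl operators that do not commute with the stabilizer map the code into its orthogonal
complement. -/
lemma inner_weyl_eq_zero [Fintype X] [Finite A] (hχ : χ ≠ 0) {w : X × X}
    (hw : ∃ s ∈ S, symp d s w ≠ 0) {φ ψ : EuclideanSpace ℂ X}
    (hφ : φ ∈ stabilizerCode χ d S ev) (hψ : ψ ∈ stabilizerCode χ d S ev) :
    inner ℂ φ (weyl χ d w ψ) = 0 := by
  rw [mem_stabilizerCode] at hφ hψ
  obtain ⟨s, hs, h1⟩ := exists_char_ne_one_of_symp_ne_zero hχ hw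
  by_cases hφ0 : φ = 0
  · simp [hφ0]
  -- `ev` is an arbitrary function; the isometry and a nonzero code vector force its value at `s` to
  -- have modulus one.
  have hev : (starRingEnd ℂ) (ev s) * ev s = 1 := by
    have h := inner_weyl_weyl χ d s φ φ
    rw [hφ s hs, inner_smul_left, inner_smul_right, ← mul_assoc] at h
    exact mul_right_cancel₀ (inner_self_ne_zero.2 hφ0) (h.trans (one_mul _).symm)
  have h := inner_weyl_weyl χ d s φ (weyl χ d w ψ)
  rw [weyl_comp_comm, hφ s hs, hψ s hs, map_smul, inner_smul_left, inner_smul_right,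
    inner_smul_right] at h
  by_contra hne
  refine h1 (mul_right_cancel₀ hne ?_)
  linear_combination h - χ (symp d s w) * inner ℂ φ (weyl χ d w ψ) * hev

/-- Weyl operators that commute with the stabilizer but do not belong to it act nontrivially
on the code. -/
lemma not_forall_weyl_eq_smul [Fintype X] [Finite A] (hχ : χ ≠ 0) (hd : d.Nondegenerate)
    (hQ : stabilizerCode χ d S ev ≠ ⊥) {w : X × X} (hwS : w ∉ S) (z : ℂ) :
    ¬ ∀ ψ ∈ stabilizerCode χ d S ev, weyl χ d w ψ = z • ψ := by
  intro h
  have hrefl : (symp d).IsRefl := (symp_isAlt d).isRefl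
  -- Since `S` is its own double complement, some `u` commutes with `S` but not with `w`. It
  -- preserves the code, so it would have to commute with `w` there if `w` acted as a scalar.
  obtain ⟨u, hu, huw⟩ : ∃ u ∈ (symp d).orthogonal S, symp d u w ≠ 0 := by
    by_contra! hh
    refine hwS ?_
    rw [← LinearMap.BilinForm.orthogonal_orthogonal (symp_nondegenerate hd) hrefl S]
    exact hh
  obtain ⟨u, hu, h1⟩ := exists_char_ne_one_of_symp_ne_zero hχ ⟨u, hu, huw⟩
  obtain ⟨ψ, hψ, hψ0⟩ := Submodule.exists_mem_ne_zero_of_ne_bot hQ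
  have hmem := weyl_mem_stabilizerCode (χ := χ) (ev := ev) (w := u) hu hψ
  have hc := weyl_comp_comm (χ := χ) (d := d) u w ψ
  rw [h ψ hψ, h _ hmem, map_smul, smul_smul] at hc
  have hiso : ∀ (v : X × X) (φ : EuclideanSpace ℂ X), φ ≠ 0 → weyl χ d v φ ≠ 0 := by
    intro v φ hφ h0
    have := inner_weyl_weyl χ d v φ φ
    rw [h0, inner_zero_left] at this
    exact hφ (inner_self_eq_zero.1 this.symm)
  have hz : z ≠ 0 := by
    rintro rfl
    exact hiso w ψ hψ0 (by simpa using h ψ hψ)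
  have := smul_left_injective ℂ (hiso u ψ hψ0) hc
  exact h1 (mul_right_cancel₀ hz (by simpa using this.symm))

/-- An isotropic `S` has a stabilizer code; its dimension is `|X| / |S|`. -/
lemma exists_stabilizerCode [Fintype X] [DecidableEq X] [Finite A] (hχ : χ ≠ 0)
    (hd : d.Nondegenerate) (hS : ∀ s ∈ S, ∀ t ∈ S, symp d s t = 0) :
    ∃ ev : X × X → ℂ,
      Module.finrank ℂ (stabilizerCode χ d S ev) * Nat.card S = Fintype.card X := by
  classical
  have : Fintype S := Fintype.ofFinite S
  obtain ⟨v, hv0, hv⟩ := exists_common_eigenvector (fun s : S => weyl χ d s) fun s t => by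
    rw [Commute, SemiconjBy, weyl_comm, hS s s.2 t t.2, AddChar.map_zero_eq_one, one_smul]
  choose e he using hv
  -- The eigenvalues obey the cocycle of the Weyl operators, so `(e s)⁻¹ • weyl χ d s` is a
  -- representation of `S`.
  have hmul : ∀ s t : S, e s * e t = χ (-d t.1.2 s.1.1) * e (s + t) := by
    intro s t
    refine smul_left_injective ℂ hv0 ?_
    have := congrArg (fun f => f v) (weyl_mul χ d s t)
    simp only [Module.End.mul_apply, LinearMap.smul_apply, he] at this
    rw [map_smul, he, smul_smul, ← Submodule.coe_add, he, smul_smul] at this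
    exact (congrArg (fun z : ℂ => z • v) (mul_comm (e s) (e t))).trans this
  have he0 : e 0 = 1 := by
    refine smul_left_injective ℂ hv0 ?_
    have := he 0
    rw [Submodule.coe_zero, weyl_zero, Module.End.one_apply] at this
    exact this.symm.trans (one_smul ℂ v).symm
  have hne : ∀ s, e s ≠ 0 := by
    intro s h0
    have := hmul s (-s)
    rw [h0, zero_mul, add_neg_cancel, he0, mul_one] at this
    have h1 := AddChar.norm_apply χ (-d (-s : S).1.2 s.1.1)
    rw [← this, norm_zero] at h1
    exact zero_ne_one h1
  have hcard : (Fintype.card S : ℂ) ≠ 0 := Nat.cast_ne_zero.2 Fintype.card_ne_zero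
  refine ⟨fun w => if h : w ∈ S then e ⟨w, h⟩ else 0, ?_⟩
  set ev : X × X → ℂ := fun w => if h : w ∈ S then e ⟨w, h⟩ else 0 with hev
  have hevS : ∀ s : S, ev s = e s := fun s => by simp [hev]
  -- Averaging that representation projects onto its fixed vectors. Only `s = 0` contributes to the
  -- trace, which equals the dimension.
  set P : Module.End ℂ (EuclideanSpace ℂ X) :=
    (Fintype.card S : ℂ)⁻¹ • ∑ s : S, (e s)⁻¹ • weyl χ d s with hP
  have hproj : LinearMap.IsProj (stabilizerCode χ d S ev) P := by
    refine ⟨fun φ => ?_, fun φ hφ => ?_⟩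
    · rw [mem_stabilizerCode]
      intro t ht
      lift t to S using ht
      rw [hevS]
      have : weyl χ d t * P = e t • P := by
        rw [hP, mul_smul_comm, smul_comm (e t), Finset.mul_sum]
        congr 1
        rw [Finset.smul_sum]
        rw [← Equiv.sum_comp (Equiv.addLeft t) (fun s => e t • (e s)⁻¹ • weyl χ d s)]
        refine Finset.sum_congr rfl fun s _ => ?_
        rw [mul_smul_comm, weyl_mul, smul_smul, smul_smul, Equiv.coe_addLeft, Submodule.coe_add]
        congr 1
        have := hmul t s
        field_simp [hne]
        linear_combination -this
      exact congrArg (fun f => f φ) this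
    · rw [mem_stabilizerCode] at hφ
      have : ∀ s : S, ((e s)⁻¹ • weyl χ d s) φ = φ := by
        intro s
        rw [LinearMap.smul_apply, hφ s s.2, hevS, smul_smul, inv_mul_cancel₀ (hne s), one_smul]
      rw [hP, LinearMap.smul_apply, LinearMap.sum_apply, Finset.sum_congr rfl fun s _ => this s,
        Finset.sum_const, Finset.card_univ, ← Nat.cast_smul_eq_nsmul ℂ, smul_smul,
        inv_mul_cancel₀ hcard, one_smul]
  have htr := hproj.trace
  rw [hP, map_smul, map_sum, Finset.sum_eq_single 0, he0, inv_one, one_smul, Submodule.coe_zero,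
    weyl_zero, LinearMap.trace_one, finrank_euclideanSpace, smul_eq_mul] at htr
  · rw [Nat.card_eq_fintype_card, ← Nat.cast_inj (R := ℂ), Nat.cast_mul, ← htr]
    field_simp
  · intro s _ hs
    rw [map_smul, trace_weyl hχ hd (fun h => hs (Subtype.ext h)), smul_zero]
  · simp

end Stabilizer

/-! ### Reduced states by Fourier inversion -/

section Reduced

variable {A X Y : Type} [Field A] [AddCommGroup X] [Module A X] [AddCommGroup Y] [Module A Y]
  [Fintype X] [Fintype Y] [DecidableEq Y]

/-- If no nonidentity Weyl operator on the subsystem `Y` has a matrix element between `φ` and `ψ`,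
then the partial trace of `|ψ⟩⟨φ|` over the complement of `Y` is a multiple of the identity. -/
lemma sum_fiber_eq {χ : AddChar A ℂ} {d : LinearMap.BilinForm A X} {dY : LinearMap.BilinForm A Y}
    (hχ : χ ≠ 0) (hdY : dY.Nondegenerate) (ι : Y →ₗ[A] X) (π : X →ₗ[A] Y)
    (hπ : ∀ b x, d (ι b) x = dY b (π x)) {φ ψ : EuclideanSpace ℂ X}
    (h : ∀ w : Y × Y, w ≠ 0 → inner ℂ φ (weyl χ d (ι w.1, ι w.2) ψ) = 0) (a u : Y) :
    (∑ x, if π x = u then ψ (x - ι a) * (starRingEnd ℂ) (φ x) else 0)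
      = if a = 0 then (Fintype.card Y : ℂ)⁻¹ * inner ℂ φ ψ else 0 := by
  have hcard : (Fintype.card Y : ℂ) ≠ 0 := Nat.cast_ne_zero.2 Fintype.card_ne_zero
  -- Character orthogonality writes the indicator of the fibre over `u` as an average of phases;
  -- summing over `x` turns each phase into a Weyl matrix element with shift `ι a`.
  have hind : ∀ x, (if π x = u then ψ (x - ι a) * (starRingEnd ℂ) (φ x) else 0)
      = (Fintype.card Y : ℂ)⁻¹ * ∑ b, χ (-dY b u) *
        (χ (d (ι b) x) * ψ (x - ι a) * (starRingEnd ℂ) (φ x)) := by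
    intro x
    have h1 : ∀ b, χ (-dY b u) * (χ (d (ι b) x) * ψ (x - ι a) * (starRingEnd ℂ) (φ x))
        = χ (dY b (π x - u)) * (ψ (x - ι a) * (starRingEnd ℂ) (φ x)) := by
      intro b
      rw [map_sub, sub_eq_add_neg (dY b (π x)), AddChar.map_add_eq_mul, hπ]
      ring
    rw [Finset.sum_congr rfl fun b _ => h1 b, ← Finset.sum_mul, sum_char_eq_ite hχ hdY]
    simp only [sub_eq_zero]
    split_ifs
    · field_simp
    · simp
  rw [Finset.sum_congr rfl fun x _ => hind x, ← Finset.mul_sum, Finset.sum_comm]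
  have hin : ∀ b, ∑ x, χ (-dY b u) * (χ (d (ι b) x) * ψ (x - ι a) * (starRingEnd ℂ) (φ x))
      = χ (-dY b u) * inner ℂ φ (weyl χ d (ι a, ι b) ψ) := by
    intro b
    rw [← Finset.mul_sum, PiLp.inner_apply]
    rfl
  rw [Finset.sum_congr rfl fun b _ => hin b]
  split_ifs with ha
  · subst ha
    rw [Finset.sum_eq_single 0]
    · rw [map_zero, LinearMap.zero_apply, neg_zero, AddChar.map_zero_eq_one, one_mul,
        map_zero]
      rw [show ((0 : X), (0 : X)) = 0 from rfl, weyl_zero, Module.End.one_apply]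
    · intro b _ hb
      rw [h (0, b) (fun h0 => hb (congrArg Prod.snd h0)), mul_zero]
    · simp
  · rw [Finset.sum_eq_zero, mul_zero]
    intro b _
    rw [h (a, b) (fun h0 => ha (congrArg Prod.fst h0)), mul_zero]

end Reduced

/-! ### The joint system and purity -/

section Joint

variable {A : Type} [Field A]

/-- The standard pairing on the labels of the joint basis. -/
def jointDot (A : Type) [Field A] (n c : ℕ) :
    LinearMap.BilinForm A ((Fin n → A) × (Fin c → A)) :=
  LinearMap.mk₂ A (fun x y => x.1 ⬝ᵥ y.1 + x.2 ⬝ᵥ y.2)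
    (fun _ _ _ => by simp only [Prod.fst_add, Prod.snd_add, add_dotProduct]; ring)
    (fun _ _ _ => by simp only [Prod.smul_fst, Prod.smul_snd, smul_dotProduct, smul_add])
    (fun _ _ _ => by simp only [Prod.fst_add, Prod.snd_add, dotProduct_add]; ring)
    (fun _ _ _ => by simp only [Prod.smul_fst, Prod.smul_snd, dotProduct_smul, smul_add])

@[simp]
lemma jointDot_apply {n c : ℕ} (x y : (Fin n → A) × (Fin c → A)) :
    jointDot A n c x y = x.1 ⬝ᵥ y.1 + x.2 ⬝ᵥ y.2 := rfl

/-- The standard pairing on `ι → A`. -/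
def dot (A ι : Type) [Field A] [Fintype ι] : LinearMap.BilinForm A (ι → A) :=
  dotProductBilin A A

@[simp]
lemma dot_apply {ι : Type} [Fintype ι] (x y : ι → A) : dot A ι x y = x ⬝ᵥ y := rfl

lemma dot_nondegenerate (ι : Type) [Fintype ι] : (dot A ι).Nondegenerate :=
  ⟨fun x h => dotProduct_eq_zero x h,
    fun x h => dotProduct_eq_zero x fun y => by rw [dotProduct_comm]; exact h y⟩

lemma jointDot_nondegenerate (n c : ℕ) : (jointDot A n c).Nondegenerate := by
  have key : ∀ x, (∀ y, jointDot A n c x y = 0) → x = 0 := fun x h => Prod.ext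
    (dotProduct_eq_zero _ fun y => by simpa using h (y, 0))
    (dotProduct_eq_zero _ fun y => by simpa using h (0, y))
  refine ⟨key, fun x h => key x fun y => ?_⟩
  rw [jointDot_apply, dotProduct_comm, dotProduct_comm x.2]
  exact h y

/-- Extension by zero of a label of the qudits in `T`. -/
def extendZero {n : ℕ} (T : Finset (Fin n)) : (T → A) →ₗ[A] (Fin n → A) where
  toFun a i := if h : i ∈ T then a ⟨i, h⟩ else 0
  map_add' a b := by ext i; by_cases h : i ∈ T <;> simp [h]
  map_smul' r a := by ext i; by_cases h : i ∈ T <;> simp [h]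

lemma extendZero_apply_mem {n : ℕ} {T : Finset (Fin n)} (a : T → A) {i : Fin n} (hi : i ∈ T) :
    extendZero T a i = a ⟨i, hi⟩ := dif_pos hi

lemma extendZero_apply_notMem {n : ℕ} {T : Finset (Fin n)} (a : T → A) {i : Fin n} (hi : i ∉ T) :
    extendZero T a i = 0 := dif_neg hi

lemma extendZero_dotProduct {n : ℕ} (T : Finset (Fin n)) (a : T → A) (x : Fin n → A) :
    extendZero T a ⬝ᵥ x = a ⬝ᵥ fun i : T => x i := by
  rw [dotProduct, dotProduct, ← Finset.sum_subset (Finset.subset_univ T), ← Finset.sum_coe_sort T]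
  · exact Finset.sum_congr rfl fun i _ => by rw [extendZero_apply_mem a i.2]
  · intro i _ hi
    rw [extendZero_apply_notMem a hi, zero_mul]

variable [Fintype A] [DecidableEq A]

/-- A code is pure to distance `d` if all nonidentity Weyl operators on fewer than `d` of the
transmitted qudits map it into its orthogonal complement. -/
lemma pureTo_of_weyl {n c : ℕ} {χ : AddChar A ℂ} (hχ : χ ≠ 0)
    {Q : Submodule ℂ (JointSpace A n c)} {d : ℕ}
    (h : ∀ w : (Fin n → A) × (Fin n → A), w ≠ 0 →
      hammingNorm (fun i => (w.1 i, w.2 i)) < d → ∀ φ ∈ Q, ∀ ψ ∈ Q,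
        inner ℂ φ (weyl χ (jointDot A n c) ((w.1, 0), (w.2, 0)) ψ) = 0) :
    PureTo Q d := by
  rintro T hT M ⟨N, hN⟩ φ hφ ψ hψ
  set ι : (T → A) →ₗ[A] (Fin n → A) × (Fin c → A) :=
    (LinearMap.inl A _ _).comp (extendZero T) with hι
  set π₀ : (Fin n → A) →ₗ[A] (T → A) := LinearMap.funLeft A A (fun i : T => (i : Fin n)) with hπ₀
  have hπι : ∀ a, π₀ (extendZero T a) = a := fun a => by
    ext i; simp [hπ₀, LinearMap.funLeft_apply, extendZero_apply_mem a i.2]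
  -- Entries vanish unless `x` and `y` agree off `T`, so each row can be summed over the difference
  -- `a` supported on `T`.
  have hNM : ∀ x y, M x y = if y ∈ Set.range (fun a => x - extendZero T a)
      then N (π₀ x) (π₀ y) else 0 := by
    intro x y
    rw [hN]
    refine if_congr ⟨fun h1 => ⟨π₀ (x - y), ?_⟩, ?_⟩ rfl rfl
    · ext i
      by_cases hi : i ∈ T
      · simp [extendZero_apply_mem _ hi, hπ₀, LinearMap.funLeft_apply]
      · simp [extendZero_apply_notMem _ hi, h1 i hi]
    · rintro ⟨a, rfl⟩ i hi
      simp [extendZero_apply_notMem _ hi]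
  have hsum : ∀ (x : Fin n → A) (f : (Fin n → A) → ℂ),
      ∑ y, M x y * f y = ∑ a : T → A, N (π₀ x) (π₀ x - a) * f (x - extendZero T a) := by
    intro x f
    have hinj : Function.Injective fun a : T → A => x - extendZero T a := fun a b hab => by
      have := congrArg π₀ (sub_right_injective hab)
      rwa [hπι, hπι] at this
    rw [← Finset.sum_subset (Finset.subset_univ (Finset.univ.image fun a => x - extendZero T a)),
      Finset.sum_image fun a _ b _ hab => hinj hab]
    · refine Finset.sum_congr rfl fun a _ => ?_
      rw [hNM, if_pos ⟨a, rfl⟩, map_sub, hπι]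
    · intro y _ hy
      rw [hNM, if_neg, zero_mul]
      simpa using hy
  have hw : ∀ w : (T → A) × (T → A), w ≠ 0 →
      inner ℂ φ (weyl χ (jointDot A n c) (ι w.1, ι w.2) ψ) = 0 := by
    intro w hw0
    refine h (extendZero T w.1, extendZero T w.2) ?_ ?_ φ hφ ψ hψ
    · rintro h0
      refine hw0 (Prod.ext ?_ ?_)
      · rw [← hπι w.1, show extendZero T w.1 = 0 from congrArg Prod.fst h0, map_zero]; rfl
      · rw [← hπι w.2, show extendZero T w.2 = 0 from congrArg Prod.snd h0, map_zero]; rfl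
    · refine lt_of_le_of_lt (Finset.card_le_card fun i hi => ?_) hT
      by_contra hiT
      simp [extendZero_apply_notMem _ hiT] at hi
  have hfib : ∀ a u : T → A, (∑ p : (Fin n → A) × (Fin c → A),
      if π₀ p.1 = u then ψ (p - ι a) * (starRingEnd ℂ) (φ p) else 0)
      = if a = 0 then (Fintype.card (T → A) : ℂ)⁻¹ * inner ℂ φ ψ else 0 := sum_fiber_eq hχ (dot_nondegenerate T) ι
    (π₀.comp (LinearMap.fst A (Fin n → A) (Fin c → A))) (d := jointDot A n c) (dY := dot A T)
    (fun b x => by simp [hι, extendZero_dotProduct, hπ₀]; rfl) hw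
  have hcardT : (Fintype.card (T → A) : ℂ) ≠ 0 := Nat.cast_ne_zero.2 Fintype.card_ne_zero
  have hLHS : inner ℂ φ (applyError M ψ)
      = (Fintype.card (T → A) : ℂ)⁻¹ * (∑ u, N u u) * inner ℂ φ ψ := by
    have h1 : inner ℂ φ (applyError M ψ) = ∑ a : T → A, ∑ u : T → A, N u (u - a) *
        ∑ p : (Fin n → A) × (Fin c → A), if π₀ p.1 = u
          then ψ (p - ι a) * (starRingEnd ℂ) (φ p) else 0 := by
      rw [PiLp.inner_apply]
      have : ∀ p : (Fin n → A) × (Fin c → A), inner ℂ (φ p) (applyError M ψ p)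
          = ∑ a : T → A, ∑ u : T → A, N u (u - a) *
            if π₀ p.1 = u then ψ (p - ι a) * (starRingEnd ℂ) (φ p) else 0 := by
        intro p
        rw [RCLike.inner_apply]
        change (∑ y, M p.1 y * ψ (y, p.2)) * _ = _
        rw [hsum p.1 fun y => ψ (y, p.2), Finset.sum_mul]
        refine Finset.sum_congr rfl fun a _ => ?_
        simp only [mul_ite, mul_zero, Finset.sum_ite_eq, Finset.mem_univ, if_true]
        rw [mul_assoc]
        rw [show (p.1 - extendZero T a, p.2) = p - ι a from Prod.ext rfl (sub_zero p.2).symm]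
      rw [Finset.sum_congr rfl fun p _ => this p, Finset.sum_comm]
      refine Finset.sum_congr rfl fun a _ => ?_
      rw [Finset.sum_comm]
      exact Finset.sum_congr rfl fun u _ => (Finset.mul_sum _ _ _).symm
    simp only [hfib] at h1
    rw [h1, Finset.sum_eq_single 0]
    · simp only [if_true, sub_zero]
      rw [← Finset.sum_mul]
      ring
    · intro a _ ha
      simp [ha]
    · simp
  -- Averaging the diagonal over translations supported on `T` relates the traces of `N ⊗ 1` and `N`
  -- without splitting the index set.
  have htrace : M.trace * Fintype.card (T → A) = (Fintype.card A : ℂ) ^ n * ∑ u, N u u := by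
    have h1 : ∀ x a, M (x + extendZero T a) (x + extendZero T a) = N (π₀ x + a) (π₀ x + a) := by
      intro x a
      rw [hNM, if_pos ⟨0, by simp⟩, map_add, hπι]
    have h2 : ∑ a : T → A, ∑ x, M (x + extendZero T a) (x + extendZero T a)
        = M.trace * Fintype.card (T → A) := by
      have : ∀ a : T → A, ∑ x, M (x + extendZero T a) (x + extendZero T a) = M.trace := fun a =>
        Equiv.sum_comp (Equiv.addRight (extendZero T a)) fun x => M x x
      rw [Finset.sum_congr rfl fun a _ => this a, Finset.sum_const, Finset.card_univ, nsmul_eq_mul,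
        mul_comm]
    rw [← h2, Finset.sum_comm]
    have : ∀ x, ∑ a : T → A, M (x + extendZero T a) (x + extendZero T a) = ∑ u, N u u := fun x => by
      rw [Finset.sum_congr rfl fun a _ => h1 x a]
      exact Equiv.sum_comp (Equiv.addLeft (π₀ x)) fun u => N u u
    rw [Finset.sum_congr rfl fun x _ => this x, Finset.sum_const, Finset.card_univ, nsmul_eq_mul]
    simp
  rw [hLHS]
  have hA : (Fintype.card A : ℂ) ^ n ≠ 0 := pow_ne_zero _ (Nat.cast_ne_zero.2 Fintype.card_ne_zero)
  congr 1
  rw [eq_div_iff hA, mul_assoc, mul_comm (∑ u, N u u), ← htrace]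
  field_simp

end Joint

/-! ### Unitary encoders from maximally mixed receivers -/

section Encoding

variable {A : Type} [Fintype A] [DecidableEq A]

/-- A subspace whose reduced states on the receiver's qudits are maximally mixed is the code of
an encoding with maximally entangled pairs. -/
lemma isEncodedSpace_of_receiver_mixed [Nonempty A] {n κ m c : ℕ} (hn : κ + m + c = n)
    {Q : Submodule ℂ (JointSpace A n c)} (hdim : Module.finrank ℂ Q = Fintype.card A ^ κ)
    (h : ∀ φ ∈ Q, ∀ ψ ∈ Q, ∀ b b' : Fin c → A,
      ∑ x : Fin n → A, ψ (x, b') * (starRingEnd ℂ) (φ (x, b))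
        = if b = b' then ((Fintype.card A : ℂ) ^ c)⁻¹ * inner ℂ φ ψ else 0) :
    IsEncodedSpace κ Q := by
  classical
  obtain ⟨a₀⟩ := ‹Nonempty A›
  set r : ℝ := Real.sqrt ((Fintype.card A : ℝ) ^ c) with hr
  have hA : (0 : ℝ) < Fintype.card A := Nat.cast_pos.2 (Fintype.card_pos_iff.2 ⟨a₀⟩)
  have hr0 : (r : ℂ) ≠ 0 := Complex.ofReal_ne_zero.2 (Real.sqrt_pos.2 (pow_pos hA c)).ne'
  have hrr : (r : ℂ) * r = (Fintype.card A : ℂ) ^ c := by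
    rw [← Complex.ofReal_mul, Real.mul_self_sqrt (pow_pos hA c).le]
    push_cast; rfl
  obtain ⟨φ⟩ : Nonempty (OrthonormalBasis (Fin κ → A) ℂ Q) :=
    ⟨(stdOrthonormalBasis ℂ Q).reindex (Fintype.equivOfCardEq (by simp [hdim]))⟩
  set J := (Fin κ → A) × (Fin m → A) × (Fin c → A) with hJ
  -- The slice of the `a`-th code basis vector at the receiver's state `b`, scaled by `r`. Mixedness
  -- of the receiver makes these slices orthonormal in `(a, b)`. Only ancilla label `a₀` matters;
  -- the rest of the basis `B` is an arbitrary completion.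
  let v : J → EuclideanSpace ℂ (Fin n → A) := fun p =>
    WithLp.toLp 2 fun x => (r : ℂ) * (φ p.1 : JointSpace A n c) (x, p.2.2)
  let s : Set J := {p | p.2.1 = fun _ => a₀}
  have hvv : ∀ p p' : J, inner ℂ (v p) (v p') = if p.1 = p'.1 ∧ p.2.2 = p'.2.2 then 1 else 0 := by
    intro p p'
    have h1 : inner ℂ (v p) (v p') = (r : ℂ) * r * ∑ x : Fin n → A,
        (φ p'.1 : JointSpace A n c) (x, p'.2.2) *
          (starRingEnd ℂ) ((φ p.1 : JointSpace A n c) (x, p.2.2)) := by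
      rw [PiLp.inner_apply, Finset.mul_sum]
      refine Finset.sum_congr rfl fun x _ => ?_
      simp only [v, RCLike.inner_apply, map_mul, Complex.conj_ofReal]
      ring
    have h2 : inner ℂ (φ p.1 : JointSpace A n c) (φ p'.1 : JointSpace A n c)
        = if p.1 = p'.1 then (1 : ℂ) else 0 := orthonormal_iff_ite.1 φ.orthonormal p.1 p'.1
    rw [h1, h _ (φ p.1).2 _ (φ p'.1).2, hrr, h2]
    have hc0 : (Fintype.card A : ℂ) ^ c ≠ 0 := by rw [← hrr]; exact mul_ne_zero hr0 hr0
    by_cases hp : p.1 = p'.1 <;> by_cases hq : p.2.2 = p'.2.2 <;> simp [hp, hq, hc0]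
  have hs : Orthonormal ℂ (s.domRestrict v) := by
    rw [orthonormal_iff_ite]
    rintro ⟨p, hp⟩ ⟨p', hp'⟩
    refine (hvv p p').trans (if_congr ?_ rfl rfl)
    rw [Subtype.mk.injEq]
    exact ⟨fun hh => Prod.ext hh.1 (Prod.ext (hp.trans hp'.symm) hh.2),
      fun hh => by simp [hh]⟩
  obtain ⟨B, hB⟩ := hs.exists_orthonormalBasis_extension_of_card_eq (by
    simp only [finrank_euclideanSpace, hJ, Fintype.card_prod, Fintype.card_fun, Fintype.card_fin]
    rw [← hn, pow_add, pow_add, mul_assoc])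
  refine ⟨m, hn, a₀, B.repr.symm, ?_⟩
  have hU : ∀ ψ b, B.repr.symm (inputState a₀ m ψ b)
      = ∑ a, ψ a • v (a, (fun _ => a₀), b) := by
    intro ψ b
    rw [← B.sum_repr_symm, Fintype.sum_prod_type]
    refine Finset.sum_congr rfl fun a _ => ?_
    rw [Finset.sum_eq_single ((fun _ => a₀), b)]
    · rw [hB _ rfl]
      simp [inputState]
    · rintro ⟨z, b'⟩ _ hne
      have : ¬ (z = (fun _ => a₀) ∧ b' = b) := fun hh => hne (Prod.ext hh.1 hh.2)
      simp [inputState, this]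
    · simp
  have henc : ∀ ψ, encode a₀ B.repr.symm ψ = ((φ.repr.symm ψ : Q) : JointSpace A n c) := by
    intro ψ
    rw [← φ.sum_repr_symm]
    ext p
    change ((r⁻¹ : ℝ) : ℂ) * B.repr.symm (inputState a₀ m ψ p.2) p.1 = _
    rw [hU]
    simp only [v, WithLp.ofLp_sum, WithLp.ofLp_smul, Finset.sum_apply, Pi.smul_apply,
      smul_eq_mul, Submodule.coe_sum, Submodule.coe_smul, Finset.mul_sum]
    refine Finset.sum_congr rfl fun a _ => ?_
    rw [Complex.ofReal_inv]
    field_simp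
  ext x
  simp only [SetLike.mem_coe, Set.mem_range, henc]
  exact ⟨fun hx => ⟨φ.repr ⟨x, hx⟩, by simp⟩, fun ⟨ψ, hψ⟩ => hψ ▸ Submodule.coe_mem _⟩

end Encoding

/-! ### Entanglement-assisted codes from isotropic subspaces -/

section Existence

variable {A : Type} [Field A] [DecidableEq A]

/-- The matrix of a Weyl operator on the transmitted qudits. -/
noncomputable def weylMatrix {n : ℕ} (χ : AddChar A ℂ) (w : (Fin n → A) × (Fin n → A)) :
    Matrix (Fin n → A) (Fin n → A) ℂ :=
  fun x y => if y = x - w.1 then χ (w.2 ⬝ᵥ x) else 0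

lemma applyError_weylMatrix [Fintype A] {n c : ℕ} (χ : AddChar A ℂ) (w : (Fin n → A) × (Fin n → A))
    (φ : JointSpace A n c) :
    applyError (weylMatrix χ w) φ = weyl χ (jointDot A n c) ((w.1, 0), (w.2, 0)) φ := by
  ext p
  change ∑ y, weylMatrix χ w p.1 y * φ (y, p.2) = _
  simp only [weylMatrix, ite_mul, zero_mul, Finset.sum_ite_eq', Finset.mem_univ, if_true,
    weyl_apply, jointDot_apply, zero_dotProduct, add_zero]
  rw [show (p.1 - w.1, p.2) = p - (w.1, 0) from Prod.ext rfl (sub_zero p.2).symm]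

lemma actsOn_weylMatrix {n : ℕ} (χ : AddChar A ℂ) (w : (Fin n → A) × (Fin n → A)) :
    ActsOn {i | (w.1 i, w.2 i) ≠ 0} (weylMatrix χ w) := by
  set T : Finset (Fin n) := {i | (w.1 i, w.2 i) ≠ 0} with hT
  have hoff : ∀ i ∉ T, w.1 i = 0 ∧ w.2 i = 0 := fun i hi => by simpa [hT] using hi
  refine ⟨fun u v => if v = u - (fun i : T => w.1 i) then χ ((fun i : T => w.2 i) ⬝ᵥ u) else 0,
    fun x y => ?_⟩
  have hw2 : w.2 = extendZero T fun i : T => w.2 i := by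
    ext i
    by_cases hi : i ∈ T
    · rw [extendZero_apply_mem _ hi]
    · rw [extendZero_apply_notMem _ hi, (hoff i hi).2]
  have hdot : w.2 ⬝ᵥ x = (fun i : T => w.2 i) ⬝ᵥ fun i : T => x i := by
    rw [← extendZero_dotProduct, ← hw2]
  rw [weylMatrix, hdot, ← ite_and]
  refine if_congr ⟨?_, fun h => ?_⟩ rfl rfl
  · rintro rfl
    exact ⟨fun i hi => by simp [(hoff i hi).1], rfl⟩
  · ext i
    by_cases hi : i ∈ T
    · exact congrFun h.2 ⟨i, hi⟩
    · simp [(hoff i hi).1, h.1 i hi]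

lemma trace_weylMatrix [Fintype A] {n : ℕ} {χ : AddChar A ℂ} (hχ : χ ≠ 0)
    {w : (Fin n → A) × (Fin n → A)} (hw : w ≠ 0) : (weylMatrix χ w).trace = 0 := by
  by_cases h1 : w.1 = 0
  · have h2 : w.2 ≠ 0 := fun h2 => hw (Prod.ext h1 h2)
    have := sum_char_eq_ite hχ (dot_nondegenerate (A := A) (Fin n)) w.2
    rw [if_neg h2] at this
    simpa [Matrix.trace, weylMatrix, h1, dotProduct_comm w.2] using this
  · refine Finset.sum_eq_zero fun x _ => if_neg fun hx => h1 ?_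
    exact sub_eq_self.1 hx.symm

/-- The entanglement-assisted stabilizer code of an isotropic space. -/
theorem exists_isEAQECC_of_isotropic [Fintype A] {n κ m c δ : ℕ} (hn : κ + m + c = n)
    (S : Submodule A (((Fin n → A) × (Fin c → A)) × ((Fin n → A) × (Fin c → A))))
    (hS : ∀ s ∈ S, ∀ t ∈ S, symp (jointDot A n c) s t = 0)
    (hcard : Fintype.card A ^ κ * Nat.card S = Fintype.card A ^ (n + c))
    (hrec : ∀ w : (Fin c → A) × (Fin c → A),
      (∀ s ∈ S, symp (jointDot A n c) s ((0, w.1), (0, w.2)) = 0) → w = 0)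
    (hdist : ∀ w : (Fin n → A) × (Fin n → A), w ≠ 0 →
      (∀ s ∈ S, symp (jointDot A n c) s ((w.1, 0), (w.2, 0)) = 0) →
        δ ≤ hammingNorm fun i => (w.1 i, w.2 i))
    (hatt : ∃ w : (Fin n → A) × (Fin n → A), w ≠ 0 ∧
      (∀ s ∈ S, symp (jointDot A n c) s ((w.1, 0), (w.2, 0)) = 0) ∧
        (hammingNorm fun i => (w.1 i, w.2 i)) = δ ∧
          (κ ≠ 0 → ((w.1, 0), (w.2, 0)) ∉ S)) :
    ∃ Q : Submodule ℂ (JointSpace A n c), IsEAQECC Q κ δ ∧ PureTo Q δ := by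
  obtain ⟨χ, hχ1⟩ := (AddChar.exists_apply_ne_zero (a := (1 : A))).2 one_ne_zero
  have hχ : χ ≠ 0 := by rintro rfl; simp at hχ1
  have hd := jointDot_nondegenerate (A := A) n c
  obtain ⟨ev, hev⟩ := exists_stabilizerCode hχ hd hS
  set Q : Submodule ℂ (JointSpace A n c) := stabilizerCode χ (jointDot A n c) S ev with hQ
  have hdim : Module.finrank ℂ Q = Fintype.card A ^ κ := by
    have hpos : 0 < Nat.card S := Nat.card_pos
    refine Nat.eq_of_mul_eq_mul_right hpos ?_
    rw [hev, hcard]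
    simp [pow_add]
  have hQ0 : Q ≠ ⊥ := by
    intro h0
    rw [h0, finrank_bot] at hdim
    exact pow_ne_zero κ Fintype.card_ne_zero hdim.symm
  have hpure : PureTo Q δ := by
    refine pureTo_of_weyl hχ fun w hw hlt φ hφ ψ hψ => inner_weyl_eq_zero hχ ?_ hφ hψ
    by_contra! hh
    exact absurd (hdist w hw hh) (not_le.2 hlt)
  have henc : IsEncodedSpace κ Q := by
    refine isEncodedSpace_of_receiver_mixed hn hdim fun φ hφ ψ hψ b b' => ?_
    have hfib : (∑ p : (Fin n → A) × (Fin c → A), if p.2 = b then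
        ψ (p - LinearMap.inr A (Fin n → A) (Fin c → A) (b - b')) * (starRingEnd ℂ) (φ p) else 0)
        = if b - b' = 0 then (Fintype.card (Fin c → A) : ℂ)⁻¹ * inner ℂ φ ψ else 0 :=
      sum_fiber_eq hχ (dot_nondegenerate (A := A) (Fin c))
      (LinearMap.inr A (Fin n → A) (Fin c → A)) (LinearMap.snd A (Fin n → A) (Fin c → A))
      (d := jointDot A n c) (fun b x => by simp) (φ := φ) (ψ := ψ) (fun w hw =>
        inner_weyl_eq_zero hχ (by by_contra! hh; exact hw (hrec w hh)) hφ hψ) (b - b') b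
    simp only [sub_eq_zero] at hfib
    rw [Fintype.card_fun, Fintype.card_fin, Nat.cast_pow] at hfib
    rw [← hfib, Fintype.sum_prod_type]
    refine Finset.sum_congr rfl fun x _ => ?_
    rw [Finset.sum_ite_eq' Finset.univ b, if_pos (Finset.mem_univ b)]
    rw [show (x, b) - LinearMap.inr A (Fin n → A) (Fin c → A) (b - b') = (x, b') by simp]
  obtain ⟨w, hw0, hw, hwδ, hwS⟩ := hatt
  have hmem : ∀ ψ ∈ Q, applyError (weylMatrix χ w) ψ ∈ Q := fun ψ hψ => by
    rw [applyError_weylMatrix]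
    exact weyl_mem_stabilizerCode hw hψ
  refine ⟨Q, ⟨henc, ⟨⟨?_, fun T hT M hM =>
    ⟨_, fun φ hφ ψ hψ => hpure T hT M hM φ hφ ψ hψ⟩, fun _ => hpure⟩, ?_⟩⟩, hpure⟩
  · rw [← hwδ]
    exact (hammingNorm_le_card_fintype).trans (by simp)
  · rintro e ⟨-, hdet, hpe⟩
    by_contra! hlt
    have hTe : Finset.card {i | (w.1 i, w.2 i) ≠ 0} < e := by rw [← hwδ] at hlt; exact hlt
    -- The operator of `w` preserves the code and is isometric. For `κ = 0` purity beyond `δ` would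
    -- give its image of `ψ` norm zero; otherwise detection would make it act as a scalar,
    -- impossible outside `S`.
    rcases eq_or_ne κ 0 with hκ | hκ
    · obtain ⟨ψ, hψ, hψ0⟩ := Submodule.exists_mem_ne_zero_of_ne_bot hQ0
      have h1 := hpe hκ _ hTe _ (actsOn_weylMatrix χ w) _ (hmem ψ hψ) ψ hψ
      rw [trace_weylMatrix hχ hw0, zero_div, zero_mul, applyError_weylMatrix,
        inner_weyl_weyl] at h1
      exact hψ0 (inner_self_eq_zero.1 h1)
    · obtain ⟨z, hz⟩ := hdet _ hTe _ (actsOn_weylMatrix χ w)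
      refine not_forall_weyl_eq_smul hχ hd hQ0 (hwS hκ) z fun ψ hψ => ?_
      rw [← applyError_weylMatrix, ← sub_eq_zero]
      refine inner_self_eq_zero (𝕜 := ℂ).1 ?_
      rw [inner_sub_right, hz _ (Q.sub_mem (hmem ψ hψ) (Q.smul_mem z hψ)) ψ hψ,
        inner_smul_right, sub_self]

end Existence

/-! ### Symplectic linear algebra -/

section Symplectic

variable {A V : Type} [Field A] [AddCommGroup V] [Module A V]
  {B : LinearMap.BilinForm A V}

/-- The form on the image of `E` is nondegenerate, so the functional `B y` restricted to it is
represented by some `E u`. -/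
lemma exists_symplectic_projection {j : ℕ} {E : ((Fin j → A) × (Fin j → A)) →ₗ[A] V}
    (hE : ∀ u v, B (E u) (E v) = symp (dot A (Fin j)) u v) (y : V) :
    ∃ u, ∀ v, B (y - E u) (E v) = 0 := by
  have hnd := symp_nondegenerate (dot_nondegenerate (A := A) (Fin j))
  refine ⟨((symp (dot A (Fin j))).toDual hnd).symm ((B y).comp E), fun v => ?_⟩
  rw [map_sub, LinearMap.sub_apply, hE, LinearMap.BilinForm.apply_toDual_symm_apply,
    LinearMap.comp_apply, sub_self]

/-- A subspace that is too large to be isotropic contains a hyperbolic pair. -/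
lemma exists_hyperbolic_pair {H : Submodule A V}
    (h : ¬ H ≤ B.orthogonal H) : ∃ v₁ ∈ H, ∃ v₂ ∈ H, B v₁ v₂ = -1 := by
  obtain ⟨x, hx, hxo⟩ := SetLike.not_le_iff_exists.1 h
  obtain ⟨y, hy, hyx⟩ : ∃ y ∈ H, B y x ≠ 0 := by
    by_contra! hh; exact hxo hh
  refine ⟨-(B y x)⁻¹ • y, H.smul_mem _ hy, x, hx, ?_⟩
  rw [map_smul, LinearMap.smul_apply, smul_eq_mul, neg_mul, inv_mul_cancel₀ hyx]

variable [FiniteDimensional A V] {C : Submodule A V}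

/-- A nondegenerate subspace splits off: `C` is the direct sum of the range of `E` and its
complement in `C`. -/
lemma finrank_inf_orthogonal_range (hB : B.IsAlt) {j : ℕ}
    {E : ((Fin j → A) × (Fin j → A)) →ₗ[A] V} (hEC : ∀ u, E u ∈ C)
    (hE : ∀ u v, B (E u) (E v) = symp (dot A (Fin j)) u v) :
    Module.finrank A (C ⊓ B.orthogonal (LinearMap.range E) : Submodule A V) + 2 * j
      = Module.finrank A C := by
  have hnd := symp_nondegenerate (dot_nondegenerate (A := A) (Fin j))
  have hinj : Function.Injective E := by
    rw [injective_iff_map_eq_zero]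
    exact fun u hu => hnd.1 u fun v => by rw [← hE, hu, map_zero, LinearMap.zero_apply]
  set K : Submodule A V := C ⊓ B.orthogonal (LinearMap.range E) with hK
  have hsup : K ⊔ LinearMap.range E = C := by
    refine le_antisymm (sup_le inf_le_left ?_) fun x hx => ?_
    · rintro _ ⟨u, rfl⟩; exact hEC u
    · obtain ⟨u, hu⟩ := exists_symplectic_projection hE x
      rw [← sub_add_cancel x (E u)]
      refine Submodule.add_mem_sup ⟨C.sub_mem hx (hEC u), ?_⟩ ⟨u, rfl⟩
      rintro _ ⟨v, rfl⟩
      exact hB.isRefl _ _ (hu v)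
  have hinf : K ⊓ LinearMap.range E = ⊥ := by
    rw [eq_bot_iff]
    rintro _ ⟨⟨-, h⟩, u, rfl⟩
    have : u = 0 := hnd.2 u fun v => by rw [← hE]; exact h _ ⟨v, rfl⟩
    rw [Submodule.mem_bot, this, map_zero]
  have h := Submodule.finrank_sup_add_finrank_inf_eq K (LinearMap.range E)
  rw [hsup, hinf, finrank_bot, LinearMap.finrank_range_of_inj hinj] at h
  simp only [Module.finrank_prod, Module.finrank_fin_fun] at h
  omega

/-- A space whose radical has codimension `2 * c` contains `c` orthogonal hyperbolic planes. -/
lemma exists_symplectic_embedding (hB : B.IsAlt) {c : ℕ}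
    (hc : Module.finrank A C
      = Module.finrank A (C ⊓ B.orthogonal C : Submodule A V) + 2 * c) :
    ∀ j ≤ c, ∃ E : ((Fin j → A) × (Fin j → A)) →ₗ[A] V, (∀ u, E u ∈ C) ∧
      ∀ u v, B (E u) (E v) = symp (dot A (Fin j)) u v := by
  intro j
  induction j with
  | zero => exact fun _ => ⟨0, fun u => C.zero_mem, fun u v => by simp⟩
  | succ j ih =>
    intro hj
    obtain ⟨E, hEC, hE⟩ := ih (by omega)
    have hfin := finrank_inf_orthogonal_range hB hEC hE
    -- While fewer than `c` planes are found, their complement in `C` has larger dimension than the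
    -- radical; a vector of it outside the radical starts the next plane.
    obtain ⟨x, ⟨hxC, hxE⟩, hxR⟩ : ∃ x ∈ C ⊓ B.orthogonal (LinearMap.range E),
        x ∉ C ⊓ B.orthogonal C := by
      by_contra! hh
      have := Submodule.finrank_mono (show C ⊓ B.orthogonal (LinearMap.range E) ≤ _ from hh)
      omega
    obtain ⟨y₀, hy₀, hxy₀⟩ : ∃ y ∈ C, B y x ≠ 0 := by
      by_contra! hh
      exact hxR ⟨hxC, hh⟩
    obtain ⟨u₀, hu₀⟩ := exists_symplectic_projection hE y₀
    have hEx : ∀ u, B (E u) x = 0 := fun u => hxE _ ⟨u, rfl⟩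
    have hxE' : ∀ u, B x (E u) = 0 := fun u => hB.isRefl _ _ (hEx u)
    set y := (B y₀ x)⁻¹ • (y₀ - E u₀) with hy
    have hyC : y ∈ C := C.smul_mem _ (C.sub_mem hy₀ (hEC u₀))
    have hyE : ∀ u, B y (E u) = 0 := fun u => by
      rw [hy, map_smul, LinearMap.smul_apply, hu₀, smul_zero]
    have hEy : ∀ u, B (E u) y = 0 := fun u => hB.isRefl _ _ (hyE u)
    have hyx : B y x = 1 := by
      rw [hy, map_smul, LinearMap.smul_apply, map_sub, LinearMap.sub_apply, hEx, sub_zero,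
        smul_eq_mul, inv_mul_cancel₀ hxy₀]
    have hxy : B x y = -1 := by rw [← hB.neg_eq y x, hyx]
    refine ⟨
      { toFun := fun u => E (Fin.tail u.1, Fin.tail u.2) + u.1 0 • x + u.2 0 • y
        map_add' := fun u v => ?_
        map_smul' := fun r u => ?_ }, fun u => ?_, fun u v => ?_⟩
    · rw [show (Fin.tail (u + v).1, Fin.tail (u + v).2)
        = (Fin.tail u.1, Fin.tail u.2) + (Fin.tail v.1, Fin.tail v.2) from rfl, map_add]
      simp only [Prod.fst_add, Prod.snd_add, Pi.add_apply]
      module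
    · rw [show (Fin.tail (r • u).1, Fin.tail (r • u).2)
        = r • (Fin.tail u.1, Fin.tail u.2) from rfl, map_smul]
      simp only [Prod.smul_fst, Prod.smul_snd, Pi.smul_apply, RingHom.id_apply, smul_eq_mul]
      module
    · exact C.add_mem (C.add_mem (hEC _) (C.smul_mem _ hxC)) (C.smul_mem _ hyC)
    · simp only [LinearMap.coe_mk, AddHom.coe_mk, map_add, LinearMap.add_apply, map_smul,
        LinearMap.smul_apply, hE, hEx, hEy, hxE', hyE, hyx, hxy, hB x, hB y, symp_apply,
        dot_apply, dotProduct, Fin.sum_univ_succ, Fin.tail, smul_eq_mul]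
      ring

/-- A space with a given radical is the sum of the radical and orthogonal hyperbolic planes. -/
lemma exists_symplectic_embedding_add_radical (hB : B.IsAlt) {c : ℕ}
    (hc : Module.finrank A C
      = Module.finrank A (C ⊓ B.orthogonal C : Submodule A V) + 2 * c) :
    ∃ E : ((Fin c → A) × (Fin c → A)) →ₗ[A] V, (∀ u, E u ∈ C) ∧
      (∀ u v, B (E u) (E v) = symp (dot A (Fin c)) u v) ∧
        ∀ x ∈ C, ∃ u, x - E u ∈ C ⊓ B.orthogonal C := by
  obtain ⟨E, hEC, hE⟩ := exists_symplectic_embedding hB hc c le_rfl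
  refine ⟨E, hEC, hE, fun x hx => ?_⟩
  obtain ⟨u, hu⟩ := exists_symplectic_projection hE x
  refine ⟨u, ?_⟩
  have hle : C ⊓ B.orthogonal C ≤ C ⊓ B.orthogonal (LinearMap.range E) := by
    refine inf_le_inf_left C (B.orthogonal_le ?_)
    rintro _ ⟨v, rfl⟩
    exact hEC v
  rw [Submodule.eq_of_le_of_finrank_eq hle
    (by have := finrank_inf_orthogonal_range hB hEC hE; omega)]
  refine ⟨C.sub_mem hx (hEC u), ?_⟩
  rintro _ ⟨v, rfl⟩
  exact hB.isRefl _ _ (hu v)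

/-- Let `D` be the orthogonal complement of `C` and let `x ∈ D`, `x ∉ C`. Then `D` contains a
hyperbolic pair; if `D` modulo its radical has dimension at least four, the pair can be chosen
orthogonal to `x`. -/
lemma exists_hyperbolic_pair_orthogonal (hB : B.IsAlt) (hnd : B.Nondegenerate)
    {κ : ℕ} (hdim : Module.finrank A (B.orthogonal C)
      = Module.finrank A (C ⊓ B.orthogonal C : Submodule A V) + 2 * κ)
    {x : V} (hxD : x ∈ B.orthogonal C) (hxC : x ∉ C) :
    ∃ v₁ ∈ B.orthogonal C, ∃ v₂ ∈ B.orthogonal C, B v₁ v₂ = -1 ∧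
      (κ ≠ 1 → B v₁ x = 0 ∧ B v₂ x = 0) := by
  by_cases hκ : κ = 1
  · obtain ⟨v₁, h₁, v₂, h₂, h⟩ := exists_hyperbolic_pair (B := B) (H := B.orthogonal C) fun hle => by
      rw [LinearMap.BilinForm.orthogonal_orthogonal hnd hB.isRefl] at hle
      exact hxC (hle hxD)
    exact ⟨v₁, h₁, v₂, h₂, h, fun h => absurd hκ h⟩
  · have hsub : ∀ v ∈ B.orthogonal (Submodule.span A {x} ⊔ C), v ∈ B.orthogonal C ∧ B v x = 0 :=
      fun v hv => ⟨B.orthogonal_le le_sup_right hv, hB.isRefl _ _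
        (hv x (Submodule.mem_sup_left (Submodule.mem_span_singleton_self x)))⟩
    obtain ⟨v₁, h₁, v₂, h₂, h⟩ := exists_hyperbolic_pair (B := B)
      (H := B.orthogonal (Submodule.span A {x} ⊔ C)) fun hle => by
        rw [LinearMap.BilinForm.orthogonal_orthogonal hnd hB.isRefl] at hle
        -- Modular law, as `x ∈ D`. If the complement of ⟨x⟩ + C were isotropic, it would lie in ⟨x⟩
        -- + R; its dimension is at least dim R + 2κ - 1, so κ ≤ 1. The remaining case κ = 0 gives D
        -- = R, against `x ∉ C`.
        have hle' : B.orthogonal (Submodule.span A {x} ⊔ C)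
            ≤ Submodule.span A {x} ⊔ C ⊓ B.orthogonal C := by
          rw [← sup_inf_assoc_of_le C
            ((Submodule.span_singleton_le_iff_mem x (B.orthogonal C)).2 hxD)]
          exact le_inf hle (B.orthogonal_le le_sup_right)
        have h1 := Submodule.finrank_mono hle'
        have h2 := Submodule.finrank_add_le_finrank_add_finrank (Submodule.span A {x})
          (C ⊓ B.orthogonal C)
        have h3 := Submodule.finrank_add_le_finrank_add_finrank (Submodule.span A {x}) C
        have h4 := finrank_span_le_card (R := A) ({x} : Set V)
        rw [Set.toFinset_singleton, Finset.card_singleton] at h4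
        have h5 := LinearMap.BilinForm.finrank_orthogonal hnd (Submodule.span A {x} ⊔ C)
        have h6 := LinearMap.BilinForm.finrank_orthogonal hnd C
        have hκ0 : κ = 0 := by omega
        have h7 := Submodule.eq_of_le_of_finrank_eq
          (inf_le_right : C ⊓ B.orthogonal C ≤ B.orthogonal C) (by omega)
        rw [← h7] at hxD
        exact hxC hxD.1
    exact ⟨v₁, (hsub _ h₁).1, v₂, (hsub _ h₂).1, h, fun _ => ⟨(hsub _ h₁).2, (hsub _ h₂).2⟩⟩

end Symplectic

/-! ### The extended stabilizer of length n + 1 -/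

section Extension

variable {A : Type} [Field A]

/-- The stabilizer of the extended code: the radical `R`, the hyperbolic pair `v₁, v₂` completed
by one further qudit, and the hyperbolic planes of `E` completed by the receiver's qudits. -/
def extendedStabilizer {n c : ℕ} (R : Submodule A ((Fin n → A) × (Fin n → A)))
    (v₁ v₂ : (Fin n → A) × (Fin n → A))
    (E : ((Fin c → A) × (Fin c → A)) →ₗ[A] ((Fin n → A) × (Fin n → A))) :
    ((R × (A × A)) × ((Fin c → A) × (Fin c → A))) →ₗ[A]
      ((Fin (n + 1) → A) × (Fin c → A)) × ((Fin (n + 1) → A) × (Fin c → A)) where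
  toFun p :=
    let z := (p.1.1 : (Fin n → A) × (Fin n → A)) + p.1.2.1 • v₁ + p.1.2.2 • v₂ + E p.2
    -- Shift and phase are swapped on the new qudit and on the receiver. The swap reverses the sign
    -- of the form, cancelling the contribution of a pair with `B v₁ v₂ = -1` and of the planes of
    -- `E`.
    ((Fin.cons p.1.2.2 z.1, p.2.2), (Fin.cons p.1.2.1 z.2, p.2.1))
  map_add' p p' := by
    ext i
    · refine Fin.cases ?_ (fun i => ?_) i <;> simp
      ring
    · simp
    · refine Fin.cases ?_ (fun i => ?_) i <;> simp
      ring
    · simp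
  map_smul' r p := by
    ext i
    · refine Fin.cases ?_ (fun i => ?_) i <;> simp
      ring
    · simp
    · refine Fin.cases ?_ (fun i => ?_) i <;> simp
      ring
    · simp

variable {n c : ℕ} {R : Submodule A ((Fin n → A) × (Fin n → A))}
  {v₁ v₂ : (Fin n → A) × (Fin n → A)}
  {E : ((Fin c → A) × (Fin c → A)) →ₗ[A] ((Fin n → A) × (Fin n → A))}

lemma extendedStabilizer_apply (r : R) (t : A × A) (u : (Fin c → A) × (Fin c → A)) :
    extendedStabilizer R v₁ v₂ E ((r, t), u)
      = ((Fin.cons t.2 (r + t.1 • v₁ + t.2 • v₂ + E u : (Fin n → A) × (Fin n → A)).1, u.2),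
        (Fin.cons t.1 (r + t.1 • v₁ + t.2 • v₂ + E u : (Fin n → A) × (Fin n → A)).2, u.1)) := rfl

lemma symp_cons (z z' : (Fin n → A) × (Fin n → A)) (s s' : A × A)
    (u u' : (Fin c → A) × (Fin c → A)) :
    symp (jointDot A (n + 1) c) ((Fin.cons s.1 z.1, u.1), (Fin.cons s.2 z.2, u.2))
      ((Fin.cons s'.1 z'.1, u'.1), (Fin.cons s'.2 z'.2, u'.2))
      = symp (dot A (Fin n)) z z' + (s.2 * s'.1 - s'.2 * s.1) + symp (dot A (Fin c)) u u' := by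
  simp only [symp_apply, jointDot_apply, dot_apply, dotProduct, Fin.sum_univ_succ, Fin.cons_zero,
    Fin.cons_succ]
  ring

lemma extendedStabilizer_injective :
    Function.Injective (extendedStabilizer R v₁ v₂ E) := by
  rw [injective_iff_map_eq_zero]
  rintro ⟨⟨r, t⟩, u⟩ h
  rw [extendedStabilizer_apply] at h
  simp only [Prod.ext_iff, Prod.fst_zero, Prod.snd_zero] at h
  obtain ⟨⟨h1, h2⟩, h3, h4⟩ := h
  have ht2 : t.2 = 0 := congrFun h1 0
  have ht1 : t.1 = 0 := congrFun h3 0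
  have hu : u = 0 := Prod.ext h4 h2
  have hz1 : _ = (0 : Fin n → A) := congrArg Fin.tail h1
  have hz2 : _ = (0 : Fin n → A) := congrArg Fin.tail h3
  rw [Fin.tail_cons, ht1, ht2, hu] at hz1 hz2
  have hr : (r : (Fin n → A) × (Fin n → A)) = 0 := by
    refine Prod.ext ?_ ?_
    · simpa using hz1
    · simpa using hz2
  rw [Submodule.coe_eq_zero] at hr
  rw [hr, hu, show t = 0 from Prod.ext ht1 ht2]
  rfl

lemma hammingNorm_succ [DecidableEq A] (w : (Fin (n + 1) → A) × (Fin (n + 1) → A)) :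
    (hammingNorm fun i => (w.1 i, w.2 i)) = (if (w.1 0, w.2 0) ≠ 0 then 1 else 0) +
      hammingNorm fun i => (Fin.tail w.1 i, Fin.tail w.2 i) := by
  rw [hammingNorm, hammingNorm, Fin.card_filter_univ_succ]
  split_ifs <;> simp [Fin.tail, add_comm]

/-- From a symplectic code to an entanglement-assisted code of length `n + 1`. -/
theorem exists_isEAQECC_of_symplectic [Fintype A] [DecidableEq A] {κ δ : ℕ}
    {C : Submodule A ((Fin n → A) × (Fin n → A))} {D : Submodule A ((Fin n → A) × (Fin n → A))}
    (hD : D = (symp (dot A (Fin n))).orthogonal C)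
    (hC : Module.finrank A C
      = Module.finrank A (C ⊓ D : Submodule A ((Fin n → A) × (Fin n → A))) + 2 * c)
    (hκ : Module.finrank A D
      = Module.finrank A (C ⊓ D : Submodule A ((Fin n → A) × (Fin n → A))) + 2 * κ) (hκ0 : 0 < κ)
    (hmin : ∀ w ∈ D, w ≠ 0 → δ ≤ hammingNorm fun i => (w.1 i, w.2 i))
    (hatt : ∃ w ∈ D, w ∉ C ∧ (hammingNorm fun i => (w.1 i, w.2 i)) = δ) :
    ∃ δ' : ℕ, δ ≤ δ' ∧ δ' ≤ δ + 1 ∧ ∃ Q : Submodule ℂ (JointSpace A (n + 1) c),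
      IsEAQECC Q (κ - 1) δ' ∧ PureTo Q δ' := by
  subst hD
  set B := symp (dot A (Fin n)) with hBdef
  have hB : B.IsAlt := symp_isAlt _
  have hnd : B.Nondegenerate := symp_nondegenerate (dot_nondegenerate _)
  set D := B.orthogonal C with hD
  obtain ⟨x, hxD, hxC, hxδ⟩ := hatt
  obtain ⟨v₁, hv₁, v₂, hv₂, hv, hvx⟩ := exists_hyperbolic_pair_orthogonal hB hnd hκ hxD hxC
  obtain ⟨E, hEC, hE, hCE⟩ := exists_symplectic_embedding_add_radical hB hC
  have hCD : ∀ y ∈ C, ∀ z ∈ D, B y z = 0 := fun y hy z hz => hz y hy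
  have hDC : ∀ z ∈ D, ∀ y ∈ C, B z y = 0 := fun z hz y hy => hB.isRefl _ _ (hz y hy)
  have hv' : B v₂ v₁ = 1 := by rw [← hB.neg_eq v₁ v₂, hv, neg_neg]
  set J := extendedStabilizer (C ⊓ D) v₁ v₂ E with hJ
  have hsymp : ∀ (r : (C ⊓ D : Submodule A _)) (t : A × A) (u : (Fin c → A) × (Fin c → A))
      (w : (Fin (n + 1) → A) × (Fin (n + 1) → A)) (y : (Fin c → A) × (Fin c → A)),
      symp (jointDot A (n + 1) c) (J ((r, t), u)) ((w.1, y.1), (w.2, y.2))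
        = B (r.1 + t.1 • v₁ + t.2 • v₂ + E u) (Fin.tail w.1, Fin.tail w.2)
          + (t.1 * w.1 0 - w.2 0 * t.2) + symp (dot A (Fin c)) (u.2, u.1) y := by
    intro r t u w y
    have h1 := symp_cons (r.1 + t.1 • v₁ + t.2 • v₂ + E u) (Fin.tail w.1, Fin.tail w.2)
      (t.2, t.1) (w.1 0, w.2 0) (u.2, u.1) y
    rwa [Fin.cons_self_tail, Fin.cons_self_tail] at h1
  have hiso : ∀ s ∈ LinearMap.range J, ∀ s' ∈ LinearMap.range J,
      symp (jointDot A (n + 1) c) s s' = 0 := by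
    rintro _ ⟨⟨⟨r, t⟩, u⟩, rfl⟩ _ ⟨⟨⟨r', t'⟩, u'⟩, rfl⟩
    have h1 := symp_cons (r.1 + t.1 • v₁ + t.2 • v₂ + E u) (r'.1 + t'.1 • v₁ + t'.2 • v₂ + E u')
      (t.2, t.1) (t'.2, t'.1) (u.2, u.1) (u'.2, u'.1)
    refine h1.trans ?_
    simp only [map_add, LinearMap.add_apply, map_smul, LinearMap.smul_apply, ← hBdef, hE,
      hCD r r.2.1 r' r'.2.2, hCD r r.2.1 v₁ hv₁, hCD r r.2.1 v₂ hv₂, hDC r r.2.2 _ (hEC _),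
      hDC v₁ hv₁ r' r'.2.1, hDC v₂ hv₂ r' r'.2.1, hB v₁, hB v₂, hv, hv', hDC v₁ hv₁ _ (hEC _),
      hDC v₂ hv₂ _ (hEC _), hCD _ (hEC u) r' r'.2.2, hCD _ (hEC u) v₁ hv₁, hCD _ (hEC u) v₂ hv₂,
      symp_apply, dot_apply, smul_eq_mul]
    rw [dotProduct_comm u'.1, dotProduct_comm u.1]
    ring
  have hrec : ∀ w : (Fin c → A) × (Fin c → A),
      (∀ s ∈ LinearMap.range J, symp (jointDot A (n + 1) c) s ((0, w.1), (0, w.2)) = 0) →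
        w = 0 := by
    intro w hw
    refine (symp_nondegenerate (dot_nondegenerate (A := A) (Fin c))).2 w fun y => ?_
    -- The receiver part of the stabilizer takes every value: the argument is swapped in advance to
    -- obtain `y`.
    have h1 := (hsymp 0 0 (y.2, y.1) 0 w).symm.trans (hw _ ⟨((0, 0), (y.2, y.1)), rfl⟩)
    have h2 : ((Fin.tail (0 : Fin (n + 1) → A) : Fin n → A),
      (Fin.tail (0 : Fin (n + 1) → A) : Fin n → A)) = 0 := rfl
    simpa only [Prod.fst_zero, Prod.snd_zero, h2, map_zero, Pi.zero_apply, mul_zero, zero_mul,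
      sub_zero, zero_add, Prod.mk.eta] using h1
  have hperp : ∀ w : (Fin (n + 1) → A) × (Fin (n + 1) → A),
      (∀ s ∈ LinearMap.range J, symp (jointDot A (n + 1) c) s ((w.1, 0), (w.2, 0)) = 0) ↔
        (Fin.tail w.1, Fin.tail w.2) ∈ D ∧
          B v₁ (Fin.tail w.1, Fin.tail w.2) = -w.1 0 ∧
            B v₂ (Fin.tail w.1, Fin.tail w.2) = w.2 0 := by
    intro w
    have hz : ∀ r t u, symp (jointDot A (n + 1) c) (J ((r, t), u)) ((w.1, 0), (w.2, 0))
        = B (r.1 + t.1 • v₁ + t.2 • v₂ + E u) (Fin.tail w.1, Fin.tail w.2)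
          + (t.1 * w.1 0 - w.2 0 * t.2) := fun r t u =>
      (hsymp r t u w 0).trans (by rw [map_zero, add_zero])
    constructor
    · intro h
      refine ⟨fun y hy => ?_, ?_, ?_⟩
      · obtain ⟨u, hu⟩ := hCE y hy
        have h1 := (hz ⟨y - E u, hu⟩ 0 u).symm.trans (h _ ⟨_, rfl⟩)
        simpa using h1
      · have h1 := (hz 0 (1, 0) 0).symm.trans (h _ ⟨_, rfl⟩)
        simp only [map_zero, Submodule.coe_zero, one_smul, zero_smul, add_zero, zero_add, one_mul,
          mul_zero, sub_zero] at h1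
        exact eq_neg_of_add_eq_zero_left h1
      · have h1 := (hz 0 (0, 1) 0).symm.trans (h _ ⟨_, rfl⟩)
        simp only [map_zero, Submodule.coe_zero, one_smul, zero_smul, add_zero, zero_add, zero_mul,
          mul_one, zero_sub] at h1
        exact add_neg_eq_zero.1 h1
    · rintro ⟨h1, h2, h3⟩ _ ⟨⟨⟨r, t⟩, u⟩, rfl⟩
      rw [hz, map_add, map_add, map_add, map_smul, map_smul]
      simp only [LinearMap.add_apply, LinearMap.smul_apply, hCD r.1 r.2.1 _ h1,
        hCD _ (hEC u) _ h1, h2, h3, smul_eq_mul]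
      ring
  have hlow : ∀ w : (Fin (n + 1) → A) × (Fin (n + 1) → A), w ≠ 0 →
      (∀ s ∈ LinearMap.range J, symp (jointDot A (n + 1) c) s ((w.1, 0), (w.2, 0)) = 0) →
        δ ≤ hammingNorm fun i => (w.1 i, w.2 i) := by
    intro w hw0 hw
    obtain ⟨h1, h2, h3⟩ := (hperp w).1 hw
    rw [hammingNorm_succ]
    -- A nonzero word has a nonzero tail, because its first coordinates are pairings of the tail
    -- with `v₁` and `v₂`.
    refine (hmin _ h1 fun h0 => hw0 ?_).trans (Nat.le_add_left _ _)
    rw [h0, map_zero] at h2 h3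
    have ht1 : Fin.tail w.1 = 0 := congrArg Prod.fst h0
    have ht2 : Fin.tail w.2 = 0 := congrArg Prod.snd h0
    refine Prod.ext (funext fun i => ?_) (funext fun i => ?_)
    · exact Fin.cases (neg_eq_zero.1 h2.symm) (fun i => congrFun ht1 i) i
    · exact Fin.cases h3.symm (fun i => congrFun ht2 i) i
  set w₀ : (Fin (n + 1) → A) × (Fin (n + 1) → A) :=
    (Fin.cons (-B v₁ x) x.1, Fin.cons (B v₂ x) x.2) with hw₀
  have hw₀S : ∀ s ∈ LinearMap.range J,
      symp (jointDot A (n + 1) c) s ((w₀.1, 0), (w₀.2, 0)) = 0 := by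
    rw [hperp]
    simp only [hw₀, Fin.tail_cons, Fin.cons_zero, neg_neg, Prod.mk.eta]
    exact ⟨hxD, trivial, trivial⟩
  have hw₀0 : w₀ ≠ 0 := by
    intro h0
    refine hxC ?_
    have h1 : x.1 = 0 := congrArg (fun w : (Fin (n + 1) → A) × (Fin (n + 1) → A) => Fin.tail w.1) h0
    have h2 : x.2 = 0 := congrArg (fun w : (Fin (n + 1) → A) × (Fin (n + 1) → A) => Fin.tail w.2) h0
    rw [show x = 0 from Prod.ext h1 h2]
    exact C.zero_mem
  have hw₀J : κ ≠ 1 → ((w₀.1, 0), (w₀.2, 0)) ∉ LinearMap.range J := by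
    rintro hκ1 ⟨⟨⟨r, t⟩, u⟩, h⟩
    rw [hJ, extendedStabilizer_apply] at h
    simp only [Prod.mk.injEq, hw₀, hvx hκ1, neg_zero] at h
    obtain ⟨⟨h1, h2⟩, h3, h4⟩ := h
    have ht : t = 0 := Prod.ext (congrFun h3 0) (congrFun h1 0)
    have hu : u = 0 := Prod.ext h4 h2
    have hz1 := congrArg Fin.tail h1
    have hz2 := congrArg Fin.tail h3
    rw [Fin.tail_cons, Fin.tail_cons, ht, hu] at hz1 hz2
    refine hxC ?_
    rw [← show r.1 = x from Prod.ext (by simpa using hz1) (by simpa using hz2)]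
    exact r.2.1
  have hwt : (hammingNorm fun i => (w₀.1 i, w₀.2 i))
      = (if (-B v₁ x, B v₂ x) ≠ 0 then 1 else 0) + δ := by
    rw [hammingNorm_succ, ← hxδ]
    rfl
  have hdims := LinearMap.BilinForm.finrank_orthogonal hnd C
  rw [← hD, Module.finrank_prod, Module.finrank_fin_fun] at hdims
  have hcard : Fintype.card A ^ (κ - 1) * Nat.card (LinearMap.range J)
      = Fintype.card A ^ (n + 1 + c) := by
    rw [Module.natCard_eq_pow_finrank (K := A), Nat.card_eq_fintype_card, ← pow_add]
    congr 1
    rw [LinearMap.finrank_range_of_inj extendedStabilizer_injective]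
    simp only [Module.finrank_prod, Module.finrank_fin_fun, Module.finrank_self]
    omega
  -- The ancilla count does not truncate: dim R + c + κ = n by `hdims`.
  have hm : κ - 1 + (n + 2 - κ - c) + c = n + 1 := by omega
  -- For `κ = 1` the new code is one-dimensional, so the exact least weight of the complement is the
  -- distance, whether or not the minimiser lies in the stabilizer.
  rcases eq_or_ne κ 1 with hκ1 | hκ1
  · obtain ⟨w, ⟨hw0, hw⟩, hwmin⟩ := Set.exists_min_image
      {w : (Fin (n + 1) → A) × (Fin (n + 1) → A) | w ≠ 0 ∧ ∀ s ∈ LinearMap.range J,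
        symp (jointDot A (n + 1) c) s ((w.1, 0), (w.2, 0)) = 0}
      (fun w => hammingNorm fun i => (w.1 i, w.2 i)) (Set.toFinite _) ⟨w₀, hw₀0, hw₀S⟩
    refine ⟨_, hlow w hw0 hw, (hwmin w₀ ⟨hw₀0, hw₀S⟩).trans ?_,
      exists_isEAQECC_of_isotropic hm _ hiso hcard hrec (fun w' h0 h => hwmin w' ⟨h0, h⟩)
        ⟨w, hw0, hw, rfl, fun h => absurd (by omega) h⟩⟩
    rw [hwt]
    split_ifs <;> omega
  · refine ⟨δ, le_rfl, Nat.le_succ δ, exists_isEAQECC_of_isotropic hm _ hiso hcard hrec hlow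
      ⟨w₀, hw₀0, hw₀S, ?_, fun _ => hw₀J hκ1⟩⟩
    rw [hwt, (hvx hκ1).1, (hvx hκ1).2]
    simp

end Extension

/-! ### From Hermitian to symplectic duality -/

section Hermitian

variable {A : Type} {K : Type*} [Field A] [Field K] [Algebra A K]

/-- The linear map `(a, b) ↦ a + γ b`, coordinatewise. -/
def combine (γ : K) (n : ℕ) : ((Fin n → A) × (Fin n → A)) →ₗ[A] (Fin n → K) where
  toFun w i := algebraMap A K (w.1 i) + γ * algebraMap A K (w.2 i)
  map_add' w w' := by ext i; simp; ring
  map_smul' r w := by ext i; simp [Algebra.smul_def]; ring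

lemma combine_apply (γ : K) {n : ℕ} (w : (Fin n → A) × (Fin n → A)) (i : Fin n) :
    combine γ n w i = algebraMap A K (w.1 i) + γ * algebraMap A K (w.2 i) := rfl

variable [Fintype A]

lemma algebraMap_pow_card (a : A) :
    algebraMap A K a ^ Fintype.card A = algebraMap A K a := by
  rw [← map_pow, FiniteField.pow_card]

lemma add_pow_card (x y : K) :
    (x + y) ^ Fintype.card A = x ^ Fintype.card A + y ^ Fintype.card A :=
  map_add (FiniteField.frobeniusAlgHom A K) x y

lemma sum_pow_card {ι : Type*} (s : Finset ι) (f : ι → K) :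
    (∑ i ∈ s, f i) ^ Fintype.card A = ∑ i ∈ s, f i ^ Fintype.card A :=
  map_sum (FiniteField.frobeniusAlgHom A K) f s

variable {γ : K}

/-- The Frobenius power fixes `A` but moves `γ`; subtracting an equation from its power isolates the
coefficient of `γ`. -/
lemma add_mul_injective (hγ : γ ^ Fintype.card A ≠ γ) :
    Function.Injective fun p : A × A => algebraMap A K p.1 + γ * algebraMap A K p.2 := by
  rintro ⟨a, b⟩ ⟨a', b'⟩ h
  have h' := congrArg (fun x => x ^ Fintype.card A) h
  simp only [add_pow_card, mul_pow, algebraMap_pow_card] at h h'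
  have hb : (algebraMap A K b - algebraMap A K b') * (γ ^ Fintype.card A - γ) = 0 := by
    linear_combination h' - h
  have hb' : b = b' := (algebraMap A K).injective
    (sub_eq_zero.1 ((mul_eq_zero.1 hb).resolve_right (sub_ne_zero.2 hγ)))
  subst hb'
  exact Prod.ext ((algebraMap A K).injective (add_right_cancel h)) rfl

lemma combine_injective (hγ : γ ^ Fintype.card A ≠ γ) (n : ℕ) :
    Function.Injective (combine (A := A) γ n) := fun w w' h => by
  have h' : ∀ i, (w.1 i, w.2 i) = (w'.1 i, w'.2 i) := fun i =>
    add_mul_injective hγ (congrFun h i)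
  exact Prod.ext (funext fun i => congrArg Prod.fst (h' i))
    (funext fun i => congrArg Prod.snd (h' i))

lemma hammingNorm_combine [DecidableEq A] [DecidableEq K] (hγ : γ ^ Fintype.card A ≠ γ) {n : ℕ}
    (w : (Fin n → A) × (Fin n → A)) :
    hammingNorm (combine γ n w) = hammingNorm fun i => (w.1 i, w.2 i) :=
  hammingNorm_comp (x := fun i => (w.1 i, w.2 i)) (fun _ (p : A × A) => algebraMap A K p.1 + γ * algebraMap A K p.2)
    (fun _ => add_mul_injective hγ) (fun _ => by simp)

/-- The link between the two dualities: antisymmetrising cancels the terms in which both factors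
come from the same half. -/
lemma hermitian_combine {n : ℕ} (w w' : (Fin n → A) × (Fin n → A)) :
    ∑ i, combine γ n w i * combine γ n w' i ^ Fintype.card A
      - ∑ i, combine γ n w' i * combine γ n w i ^ Fintype.card A
      = (γ - γ ^ Fintype.card A) * algebraMap A K (symp (dot A (Fin n)) w w') := by
  simp only [symp_apply, dot_apply, dotProduct, map_sub, map_sum, map_mul, combine_apply,
    add_pow_card, mul_pow, algebraMap_pow_card]
  rw [← Finset.sum_sub_distrib, ← Finset.sum_sub_distrib, Finset.mul_sum]
  refine Finset.sum_congr rfl fun i _ => ?_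
  ring

variable [Fintype K]

lemma finrank_eq_two (hK : Fintype.card K = Fintype.card A ^ 2) : Module.finrank A K = 2 := by
  have h := Module.card_eq_pow_finrank (K := A) (V := K)
  rw [hK] at h
  exact (Nat.pow_right_injective Fintype.one_lt_card h).symm

lemma exists_pow_card_ne (hK : Fintype.card K = Fintype.card A ^ 2) :
    ∃ γ : K, γ ^ Fintype.card A ≠ γ := by
  by_contra! h
  have h1 : FiniteField.frobeniusAlgHom A K = 1 := AlgHom.ext h
  have h2 := FiniteField.orderOf_frobeniusAlgHom A K
  rw [h1, orderOf_one, finrank_eq_two hK] at h2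
  omega

/-- The coordinatewise identification of `A × A` with the quadratic extension `K`. -/
noncomputable def combineEquiv (hK : Fintype.card K = Fintype.card A ^ 2)
    (hγ : γ ^ Fintype.card A ≠ γ) (n : ℕ) :
    ((Fin n → A) × (Fin n → A)) ≃ₗ[A] (Fin n → K) :=
  LinearMap.linearEquivOfInjective (combine γ n) (combine_injective hγ n) (by
    simp [Module.finrank_pi_fintype, finrank_eq_two hK, mul_two])

lemma combineEquiv_apply (hK : Fintype.card K = Fintype.card A ^ 2)
    (hγ : γ ^ Fintype.card A ≠ γ) {n : ℕ} (w : (Fin n → A) × (Fin n → A)) :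
    combineEquiv hK hγ n w = combine γ n w := rfl

lemma finrank_comap_combine (hK : Fintype.card K = Fintype.card A ^ 2)
    (hγ : γ ^ Fintype.card A ≠ γ) {n : ℕ} (P : Submodule K (Fin n → K)) :
    Module.finrank A ((P.restrictScalars A).comap (combine γ n)) = 2 * Module.finrank K P := by
  have h1 : (P.restrictScalars A).comap (combine γ n)
      = (P.restrictScalars A).map ((combineEquiv hK hγ n).symm : _ →ₗ[A] _) :=
    (Submodule.map_equiv_eq_comap_symm (combineEquiv hK hγ n).symm _).symm
  rw [h1, LinearEquiv.finrank_map_eq, ← finrank_eq_two hK]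
  exact (Module.finrank_mul_finrank A K P).symm

lemma hermitian_swap {n : ℕ} (hK : Fintype.card K = Fintype.card A ^ 2) (x y : Fin n → K) :
    (∑ i, x i * y i ^ Fintype.card A) ^ Fintype.card A = ∑ i, y i * x i ^ Fintype.card A := by
  rw [sum_pow_card]
  refine Finset.sum_congr rfl fun i _ => ?_
  rw [mul_pow, ← pow_mul, ← sq, ← hK, FiniteField.pow_card, mul_comm]

/-- Symplectic orthogonality only says that the Hermitian product h of `w` and `y` satisfies h^q =
h. As `C` is closed under multiplication by `γ`, also (γ^q h)^q = γ^q h, that is γ h = γ^q h, and h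
= 0. -/
lemma comap_hermitianDual (hK : Fintype.card K = Fintype.card A ^ 2)
    (hγ : γ ^ Fintype.card A ≠ γ) {n : ℕ} (C : Submodule K (Fin n → K)) :
    ((hermitianDual (Fintype.card A) C).restrictScalars A).comap (combine γ n)
      = (symp (dot A (Fin n))).orthogonal ((C.restrictScalars A).comap (combine γ n)) := by
  ext w
  constructor
  · intro hw w' hw'
    have h1 : ∑ i, combine γ n w i * combine γ n w' i ^ Fintype.card A = 0 := hw _ hw'
    have h2 := hermitian_swap hK (combine γ n w) (combine γ n w')
    rw [h1, zero_pow Fintype.card_ne_zero] at h2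
    have h3 := hermitian_combine (γ := γ) w' w
    rw [h1, ← h2, sub_zero] at h3
    have h4 := (mul_eq_zero.1 h3.symm).resolve_left (sub_ne_zero.2 hγ.symm)
    exact (map_eq_zero _).1 h4
  · intro hw
    have key : ∀ y ∈ C, (∑ i, combine γ n w i * y i ^ Fintype.card A) ^ Fintype.card A
        = ∑ i, combine γ n w i * y i ^ Fintype.card A := by
      intro y hy
      obtain ⟨w', rfl⟩ := (combineEquiv hK hγ n).surjective y
      rw [combineEquiv_apply] at hy ⊢
      have h3 := hermitian_combine (γ := γ) w' w
      rw [show symp (dot A (Fin n)) w' w = 0 from hw w' hy, map_zero, mul_zero] at h3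
      rw [hermitian_swap hK]
      exact sub_eq_zero.1 h3
    intro y hy
    have h1 := key y hy
    have h2 := key (γ • y) (C.smul_mem γ hy)
    set h := ∑ i, combine γ n w i * y i ^ Fintype.card A with hh
    have h3 : ∑ i, combine γ n w i * (γ • y) i ^ Fintype.card A = γ ^ Fintype.card A * h := by
      rw [hh, Finset.mul_sum]
      refine Finset.sum_congr rfl fun i _ => ?_
      rw [Pi.smul_apply, smul_eq_mul, mul_pow]
      ring
    rw [h3, mul_pow, ← pow_mul, ← sq, ← hK, FiniteField.pow_card, h1] at h2
    have h4 : (γ ^ Fintype.card A - γ) * h = 0 := by linear_combination -h2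
    exact (mul_eq_zero.1 h4).resolve_left (sub_ne_zero.2 hγ)

/-- From a pure Hermitian construction to an entanglement-assisted code of length `n + 1`, for
qudits labelled by the subfield. -/
theorem exists_isEAQECC_of_pureHermitianConstruction [DecidableEq A] [DecidableEq K]
    {n κ δ c : ℕ} (hK : Fintype.card K = Fintype.card A ^ 2) (hκ : 0 < κ)
    {C : Submodule K (Fin n → K)}
    (hC : PureHermitianConstruction (Fintype.card A) C κ δ c) :
    ∃ δ' : ℕ, δ ≤ δ' ∧ δ' ≤ δ + 1 ∧ ∃ Q : Submodule ℂ (JointSpace A (n + 1) c),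
      IsEAQECC Q (κ - 1) δ' ∧ PureTo Q δ' := by
  obtain ⟨⟨hebits, hlog, -, hnle⟩, hpure⟩ := hC
  obtain ⟨γ, hγ⟩ := exists_pow_card_ne hK
  set D := hermitianDual (Fintype.card A) C with hDdef
  set pull := fun P : Submodule K (Fin n → K) => (P.restrictScalars A).comap (combine γ n)
    with hpull
  have hfin : ∀ P, Module.finrank A (pull P) = 2 * Module.finrank K P :=
    finrank_comap_combine hK hγ
  have hinf : pull C ⊓ pull D = pull (hermitianHull (Fintype.card A) C) := rfl
  have hdual : pull D = (symp (dot A (Fin n))).orthogonal (pull C) := comap_hermitianDual hK hγ C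
  have hdim := LinearMap.BilinForm.finrank_orthogonal
    (symp_nondegenerate (dot_nondegenerate (A := A) (Fin n))) (pull C)
  rw [← hdual, hfin, hfin, Module.finrank_prod, Module.finrank_fin_fun] at hdim
  have hCn : Module.finrank K C ≤ n := by
    simpa using Submodule.finrank_le C
  -- Otherwise the hull is D, whence c = 2k - n and κ = 0. So δ is attained outside the hull, hence
  -- outside C.
  have hnot : ¬ D ≤ C := by
    intro hle
    have h1 : hermitianHull (Fintype.card A) C = D := inf_eq_right.2 hle
    rw [h1] at hebits
    omega
  obtain ⟨v, ⟨hvD, hvH⟩, hv0, hvδ⟩ := (hnle hnot).1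
  obtain ⟨w, rfl⟩ := (combineEquiv hK hγ n).surjective v
  rw [combineEquiv_apply] at hvD hvH hvδ
  refine exists_isEAQECC_of_symplectic (κ := κ) (δ := δ) (c := c) hdual ?_ ?_ hκ ?_ ?_
  · rw [hinf, hfin, hfin]
    omega
  · rw [hinf, hfin, hfin]
    omega
  · intro w hw hw0
    rw [← hammingNorm_combine hγ]
    refine hpure.2 ⟨_, hw, fun h0 => hw0 (combine_injective hγ n ?_), rfl⟩
    rw [h0, map_zero]
  · refine ⟨w, hvD, fun hwC => hvH ⟨hwC, hvD⟩, ?_⟩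
    rw [← hammingNorm_combine hγ, hvδ]

end Hermitian

/-- A field with `q ^ 2` elements has a subfield with `q` elements. -/
lemma exists_field_fin_of_card_eq_sq {q : ℕ} {K : Type*} [Field K] [Fintype K]
    (hK : Fintype.card K = q ^ 2) :
    ∃ _ : Field (Fin q), Nonempty (Algebra (Fin q) K) := by
  obtain ⟨p, hp⟩ := CharP.exists K
  obtain ⟨m, hpp, hm⟩ := FiniteField.card K p
  have : Fact p.Prime := ⟨hpp⟩
  obtain ⟨j, -, hj⟩ := (Nat.dvd_prime_pow hpp).1 (hm ▸ hK ▸ Dvd.intro_left q (sq q).symm)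
  have hmj : (m : ℕ) = j * 2 := by
    rw [hK, hj, ← pow_mul] at hm
    exact (Nat.pow_right_injective hpp.two_le hm).symm
  have hj0 : j ≠ 0 := by
    rintro rfl
    exact m.ne_zero (by omega)
  let : Algebra (ZMod p) K := ZMod.algebra K p
  have hfK : Module.finrank (ZMod p) K = m := by
    have h := Module.card_eq_pow_finrank (K := ZMod p) (V := K)
    rw [hm, ZMod.card] at h
    exact (Nat.pow_right_injective hpp.two_le h).symm
  -- With q = p^j the degree of `K` is 2j, so the field with p^j elements embeds. Its structure is
  -- then carried to `Fin q`, the labels of the qudits.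
  obtain ⟨f⟩ := FiniteField.nonempty_algHom_of_finrank_dvd (F := ZMod p) (K := GaloisField p j)
    (L := K) (by rw [GaloisField.finrank p hj0, hfK, hmj]; exact Dvd.intro 2 rfl)
  have hcard : Nat.card (GaloisField p j) = q := by rw [GaloisField.card p j hj0, hj]
  let e : Fin q ≃ GaloisField p j := ((Nat.equivFinOfCardPos (by
    rw [hcard, hj]; exact pow_ne_zero _ hpp.ne_zero)).trans (finCongr hcard)).symm
  let : Field (Fin q) := e.field
  exact ⟨e.field, ⟨((f : GaloisField p j →+* K).comp
    (e.ringEquiv : Fin q →+* GaloisField p j)).toAlgebra⟩⟩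

end EAQ

theorem mainTheorem4 (q n κ δ c : ℕ) {K : Type*} [Field K] [Fintype K] [DecidableEq K]
    (hK : Fintype.card K = q ^ 2) (hκ : 0 < κ) (hc : 0 < c)
    (C : Submodule K (Fin n → K)) (hC : EAQ.PureHermitianConstruction q C κ δ c) :
    ∃ δ' : ℕ, δ ≤ δ' ∧ δ' ≤ δ + 1 ∧
      ∃ Q' : Submodule ℂ (EAQ.JointSpace (Fin q) (n + 1) c),
        EAQ.IsEAQECC Q' (κ - 1) δ' ∧ EAQ.PureTo Q' δ' := by
  obtain ⟨hF, ⟨hA⟩⟩ := EAQ.exists_field_fin_of_card_eq_sq hK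
  have hq : Fintype.card (Fin q) = q := Fintype.card_fin q
  exact EAQ.exists_isEAQECC_of_pureHermitianConstruction (A := Fin q) (K := K) (C := C)
    (by rw [hq]; exact hK) hκ (by rwa [hq])
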